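/- Vertices of a rooted ordered tree are labelled by finite sequences of positive integers: the root is $\emptyset$, and the $j$-th child (in order of birth) of $x=(x_1,\dots,x_k)$ is $(x_1,\dots,x_k,j)$; a tree is identified with the set of labels of its vertices. Write $\deg(x,T)$ for the graph degree of the vertex $x$ in $T$ (and $\deg(x,T)=0$ if $x\notin T$). Let $\beta>-1$, and let $(G_n)_{n\ge1}$ be the random trees with $G_1=\{\emptyset\}$, $G_2=\{\emptyset,(1)\}$ such that for $n\ge2$, given $G_1,\dots,G_n$, a new vertex is attached as the next child to each vertex $x$ of $G_n$ with probability $$\frac{\deg(x,G_n)+\beta}{S_n},\qquad S_n=2n-2+n\beta .$$ Then there is a positive random variable $\zeta_0$ with $\deg(\emptyset,G_n)/n^{1/(2+\beta)}\to\zeta_0$ almost surely. Moreover, for every $k\ge1$ and every sequence $x=(x_1,\dots,x_k)$ of positive integers there is a positive random variable $\zeta_x$ with $$\frac{\deg(x,G_n)}{n^{1/(2+\beta)}}\to\zeta_x\quad\text{almost surely as } n\to\infty,$$ and $\zeta_x$ has the same distribution as a product $\zeta_0'\,\xi_1\cdots\xi_k$ of independent random variables, where $\zeta_0'$ has the distribution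 of $\zeta_0$; $\xi_1$ has distribution $\mathrm{Beta}(1+\beta,x_1-1)$ if $x_1>1$ and $\xi_1\equiv1$ if $x_1=1$; and $\xi_s$ has distribution $\mathrm{Beta}(1+\beta,x_s)$ for $2\le s\le k$. -/

import Mathlib

open MeasureTheory ProbabilityTheory Filter Topology

/-- A finite rooted ordered tree (family tree), identified with the finite set of the labels of its
vertices.  The root is the empty sequence, and the `j`-th child (`j = 1, 2, …`) of the vertex `x`
is the sequence `x ++ [j]`. -/
@[ext]
structure FamilyTree where
  verts : Finset (List ℕ+)
  root_mem : [] ∈ verts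
  parent_mem : ∀ (x : List ℕ+) (j : ℕ+), x ++ [j] ∈ verts → x ∈ verts
  sibling_mem : ∀ (x : List ℕ+) (i j : ℕ+), i ≤ j → x ++ [j] ∈ verts → x ++ [i] ∈ verts

namespace FamilyTree

/-- The set of finite rooted ordered trees is countable and carries the discrete σ-algebra. -/
instance : MeasurableSpace FamilyTree := ⊤

/-- `IsChild x y`: the vertex `y` is a child of the vertex `x`. -/
def IsChild (x y : List ℕ+) : Prop := ∃ j : ℕ+, y = x ++ [j]

open Classical in
/-- The number of children of `x` in `T`. -/
noncomputable def numChildren (T : FamilyTree) (x : List ℕ+) : ℕ :=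
  (T.verts.filter fun y => IsChild x y).card

open Classical in
/-- The degree of `x` in `T`: the number of vertices joined to `x` by a parent-child edge
(it is `0` if `x` is not a vertex of `T`). -/
noncomputable def degree (T : FamilyTree) (x : List ℕ+) : ℕ :=
  (T.verts.filter fun y => x ∈ T.verts ∧ (IsChild x y ∨ IsChild y x)).card

/-- The label of the next child to be born to `x` in `T`. -/
noncomputable def nextChild (T : FamilyTree) (x : List ℕ+) : List ℕ+ :=
  x ++ [(T.numChildren x).succPNat]

/-- `T'` arises from `T` when a new vertex is attached to the vertex `x` of `T`. -/
def IsGrowth (T : FamilyTree) (x : List ℕ+) (T' : FamilyTree) : Prop :=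
  T'.verts = insert (T.nextChild x) T.verts

end FamilyTree

/-- The random tree process `G₁, G₂, …` (the value `G 0` plays no role) in which a vertex of
degree `d` has weight `d + β`.  It starts from the one-vertex tree; the second vertex can only be
attached to the root; and for `n ≥ 2`, given `G₁, …, Gₙ`, the new vertex is attached to the vertex
`x` of `Gₙ` with probability `(deg (x, Gₙ) + β) / Sₙ`, where `Sₙ = 2n - 2 + nβ`. -/
structure IsPreferentialAttachmentTree {Ω : Type*} [MeasurableSpace Ω] (β : ℝ) (μ : Measure Ω)
    (G : ℕ → Ω → FamilyTree) : Prop where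
  measurable : ∀ n : ℕ, 1 ≤ n → Measurable (G n)
  start : ∀ᵐ ω ∂μ, (G 1 ω).verts = {[]}
  first_step : ∀ᵐ ω ∂μ, (G 1 ω).IsGrowth [] (G 2 ω)
  step : ∀ n : ℕ, 2 ≤ n → ∀ t : ℕ → FamilyTree,
    μ {ω | ∀ i ∈ Finset.Icc 1 n, G i ω = t i} ≠ 0 →
    ∀ x ∈ (t n).verts,
      (cond μ {ω | ∀ i ∈ Finset.Icc 1 n, G i ω = t i}).real {ω | (t n).IsGrowth x (G (n + 1) ω)} =
        (((t n).degree x : ℝ) + β) / (2 * (n : ℝ) - 2 + (n : ℝ) * β)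

/-- The law of the factor `ξ₍ᵢ₊₁₎` attached to `x = (x₁, …, x_k)` (positions are counted from `0`
in `x`): `Beta (1 + β, x₁ - 1)`, or the point mass at `1` if `x₁ = 1`, for the first factor, and
`Beta (1 + β, x_s)` for the factors with `s ≥ 2`. -/
noncomputable def factorLaw (β : ℝ) (x : List ℕ+) (i : Fin x.length) : Measure ℝ :=
  if (i : ℕ) = 0 then
    if x.get i = 1 then Measure.dirac 1 else betaMeasure (1 + β) (((x.get i : ℕ) : ℝ) - 1)
  else betaMeasure (1 + β) ((x.get i : ℕ) : ℝ)

/-!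
The degrees are followed through Gamma ratios. For `d ≥ 1` put `g_p(d) = Γ(d + β + p) / Γ(d + β)`
(`degreeMoment`). Since `g_p(d + 1) = g_p(d) (1 + p / (d + β))` and a vertex of degree `d` is
chosen with probability `(d + β) / Sₙ`, the conditional expectation of `g_p(deg (x, Gₙ₊₁))` given
the past is `(1 + p / Sₙ) g_p(deg (x, Gₙ))` as soon as `x` is present. The product of these
deterministic factors is again a Gamma ratio (`growthFactor`), of order `n ^ (p / (2 + β))`.

*Almost sure convergence.* After `x` is born, the quotient of the two quantities is a nonnegative
martingale for each `p > -(1 + β)` (`martingale_degreeMoment`), so it converges. The exponent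
`p = 1` gives the limit of `deg (x, Gₙ) / n ^ (1 / (2 + β))`, and a negative exponent shows that
this limit does not vanish (`exists_pos_limit`). In particular the degree of `x` tends to infinity,
so all its children are born almost surely.

*The law of the limit.* Let `k` be the degree of `y` just after the birth of its `j`-th child `x`.
The combination `g_p(1) g_p(deg y) - g_p(k) g_p(deg x)`, taken to be `0` before the birth of `x`,
starts from `0` at this birth and obeys the same recursion, hence has expectation `0` at all times
(`integral_familyMoment`). The normalized moments are bounded in `L²`, which is the bound for the
exponent `2 p`, so this passes to the limit: `E ζ_x ^ p = g_p(1) / g_p(k) * E ζ_y ^ p` for `p ≥ 0`.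
The ratio `g_p(1) / g_p(k)` is the moment of order `p` of `Beta (1 + β, k - 1)` (of the point mass
at `1` if `k = 1`), with `k = j` if `y` is the root and `k = j + 1` otherwise. By induction along
`x`, the moments of positive real orders of `ζ_x` and of the product agree, and these determine the
law of a positive random variable (`map_eq_map_of_lintegral_rpow_eq`).
-/

/-! ### Degrees in growing family trees -/

namespace FamilyTree

/-- The labels of the children of `x` are `1, …, numChildren x`. -/
lemma append_mem_iff (T : FamilyTree) (x : List ℕ+) (j : ℕ+) :
    x ++ [j] ∈ T.verts ↔ (j : ℕ) ≤ T.numChildren x := by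
  classical
  have hinj : Function.Injective (fun i : ℕ+ => x ++ [i]) := fun a b h => by simpa using h
  have hcard : T.numChildren x = (T.verts.preimage (fun i : ℕ+ => x ++ [i]) hinj.injOn).card := by
    rw [numChildren, ← Finset.card_map ⟨_, hinj⟩]
    congr 1
    ext y
    rw [Finset.mem_filter]
    simp only [IsChild, Finset.mem_map, Finset.mem_preimage, Function.Embedding.coeFn_mk]
    constructor
    · rintro ⟨hy, i, rfl⟩
      exact ⟨i, hy, rfl⟩
    · rintro ⟨i, hi, rfl⟩
      exact ⟨hi, i, rfl⟩
  rw [hcard]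
  constructor
  · intro h
    have hsub : Finset.Icc 1 j ⊆ T.verts.preimage (fun i : ℕ+ => x ++ [i]) hinj.injOn := by
      intro i hi
      rw [Finset.mem_preimage]
      exact T.sibling_mem x i j (Finset.mem_Icc.1 hi).2 h
    simpa using Finset.card_le_card hsub
  · intro h
    by_contra hj
    have hsub : T.verts.preimage (fun i : ℕ+ => x ++ [i]) hinj.injOn ⊆ Finset.Ico 1 j := by
      intro i hi
      rw [Finset.mem_preimage] at hi
      refine Finset.mem_Ico.2 ⟨one_le, ?_⟩
      by_contra hij
      exact hj (T.sibling_mem x j i (not_lt.1 hij) hi)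
    have := Finset.card_le_card hsub
    have hpos := j.pos
    simp at this
    omega

lemma nextChild_notMem (T : FamilyTree) (x : List ℕ+) : T.nextChild x ∉ T.verts := by
  rw [nextChild, append_mem_iff]
  simp

lemma nextChild_injective (T : FamilyTree) : Function.Injective T.nextChild := by
  intro x y h
  have := congrArg List.dropLast h
  simpa [nextChild] using this

lemma numChildren_eq_zero {T : FamilyTree} {x : List ℕ+} (hx : x ∉ T.verts) :
    T.numChildren x = 0 := by
  classical
  rw [numChildren, Finset.card_eq_zero, Finset.filter_eq_empty_iff]
  rintro y hy ⟨j, rfl⟩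
  exact hx (T.parent_mem x j hy)

lemma degree_of_notMem {T : FamilyTree} {x : List ℕ+} (hx : x ∉ T.verts) : T.degree x = 0 := by
  simp [degree, hx]

lemma degree_of_mem {T : FamilyTree} {x : List ℕ+} (hx : x ∈ T.verts) :
    T.degree x = T.numChildren x + if x = [] then 0 else 1 := by
  classical
  have hdisj : Disjoint (T.verts.filter fun y => IsChild x y)
      (T.verts.filter fun y => IsChild y x) := by
    rw [Finset.disjoint_filter]
    rintro y - ⟨i, rfl⟩ ⟨j, h⟩
    have := congrArg List.length h
    simp at this
  have hpar : (T.verts.filter fun y => IsChild y x).card = if x = [] then 0 else 1 := by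
    rcases List.eq_nil_or_concat' x with rfl | ⟨z, j, rfl⟩
    · simp [IsChild]
    · rw [if_neg (by simp), Finset.card_eq_one]
      refine ⟨z, ?_⟩
      ext y
      rw [Finset.mem_filter, Finset.mem_singleton]
      simp only [IsChild]
      constructor
      · rintro ⟨-, i, hi⟩
        have := congrArg List.dropLast hi
        simpa using this.symm
      · rintro rfl
        exact ⟨T.parent_mem _ j hx, j, rfl⟩
  rw [degree, ← hpar, numChildren, ← Finset.card_union_of_disjoint hdisj, ← Finset.filter_or]
  simp [hx]

lemma degree_pos {T : FamilyTree} {x : List ℕ+} (hx : x ∈ T.verts) (h2 : 2 ≤ T.verts.card) :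
    1 ≤ T.degree x := by
  rw [degree_of_mem hx]
  split_ifs with h
  · subst h
    by_contra hc
    have h0 : T.numChildren [] = 0 := by omega
    -- a tree whose root has no child is reduced to its root
    have hall : ∀ y : List ℕ+, y ∈ T.verts → y = [] := by
      intro y
      induction y using List.reverseRecOn with
      | nil => simp
      | append_singleton z j ih =>
        intro hz
        obtain rfl := ih (T.parent_mem z j hz)
        rw [append_mem_iff, h0] at hz
        exact absurd hz (by simp)
    have : T.verts.card ≤ 1 :=
      Finset.card_le_one.2 fun a ha b hb => (hall a ha).trans (hall b hb).symm
    omega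
  · omega

/-- Handshake lemma for family trees: every vertex but the root has exactly one parent. -/
lemma sum_degree (T : FamilyTree) : ∑ x ∈ T.verts, T.degree x = 2 * (T.verts.card - 1) := by
  classical
  have h1 : ∑ x ∈ T.verts, T.numChildren x = (T.verts.erase []).card := by
    rw [Finset.card_eq_sum_card_fiberwise (f := List.dropLast) (t := T.verts)]
    · refine Finset.sum_congr rfl fun x _ => ?_
      rw [numChildren]
      congr 1
      ext y
      rcases List.eq_nil_or_concat' y with rfl | ⟨z, j, rfl⟩
      · rw [Finset.mem_filter]
        simp [IsChild]
      · rw [Finset.mem_filter, Finset.mem_filter, Finset.mem_erase]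
        simp only [IsChild]
        constructor
        · rintro ⟨hz, i, hi⟩
          have := congrArg List.dropLast hi
          exact ⟨⟨by simp, hz⟩, by simpa using this⟩
        · rintro ⟨⟨-, hz⟩, rfl⟩
          exact ⟨hz, j, by simp⟩
    · intro y hy
      rcases List.eq_nil_or_concat' y with rfl | ⟨z, j, rfl⟩
      · simp at hy
      · simp only [Finset.coe_erase, Set.mem_sdiff, Finset.mem_coe] at hy
        simpa using T.parent_mem z j hy.1
  have h2 : ∑ x ∈ T.verts, (if x = [] then 0 else 1) = (T.verts.erase []).card := by
    rw [Finset.card_eq_sum_ones, ← Finset.filter_ne', Finset.sum_filter]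
    simp [ite_not]
  rw [Finset.sum_congr rfl fun x hx => degree_of_mem hx, Finset.sum_add_distrib, h1, h2,
    Finset.card_erase_of_mem T.root_mem]
  ring

namespace IsGrowth

variable {T T' : FamilyTree} {x : List ℕ+}

lemma card_eq (h : T.IsGrowth x T') : T'.verts.card = T.verts.card + 1 := by
  rw [h, Finset.card_insert_of_notMem (T.nextChild_notMem x)]

lemma subset (h : T.IsGrowth x T') : T.verts ⊆ T'.verts := by
  rw [h]; exact Finset.subset_insert _ _

lemma eq_of_eq {z : List ℕ+} (h : T.IsGrowth x T') (h' : T.IsGrowth z T') : x = z := by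
  unfold IsGrowth at h h'
  rw [h] at h'
  have hmem : T.nextChild x ∈ insert (T.nextChild z) T.verts := h' ▸ Finset.mem_insert_self _ _
  rcases Finset.mem_insert.1 hmem with h1 | h1
  · exact T.nextChild_injective h1
  · exact absurd h1 (T.nextChild_notMem x)

lemma numChildren_eq (h : T.IsGrowth x T') (z : List ℕ+) :
    T'.numChildren z = T.numChildren z + if z = x then 1 else 0 := by
  classical
  have hc : IsChild z (T.nextChild x) ↔ z = x := by
    constructor
    · rintro ⟨j, hj⟩
      have := congrArg List.dropLast hj
      simpa [nextChild] using this.symm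
    · rintro rfl
      exact ⟨_, rfl⟩
  rw [numChildren, h, Finset.filter_insert]
  simp only [hc]
  split_ifs with hz
  · rw [Finset.card_insert_of_notMem]
    · rfl
    · simp [T.nextChild_notMem x]
  · rfl

lemma degree_of_mem (h : T.IsGrowth x T') {z : List ℕ+} (hz : z ∈ T.verts) :
    T'.degree z = T.degree z + if z = x then 1 else 0 := by
  rw [FamilyTree.degree_of_mem (h.subset hz), FamilyTree.degree_of_mem hz, h.numChildren_eq]
  ring

lemma degree_of_notMem (h : T.IsGrowth x T') {z : List ℕ+} (hz : z ∉ T.verts)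
    (hz' : z ∈ T'.verts) : T'.degree z = 1 ∧ z = T.nextChild x := by
  have hzx : z = T.nextChild x := by
    rw [h] at hz'
    exact (Finset.mem_insert.1 hz').resolve_right hz
  refine ⟨?_, hzx⟩
  have hne : z ≠ x := by
    intro h1
    have := congrArg List.length (h1.symm.trans hzx)
    simp [nextChild] at this
  have hnil : z ≠ [] := by
    rw [hzx]; simp [nextChild]
  rw [FamilyTree.degree_of_mem hz', h.numChildren_eq, numChildren_eq_zero hz, if_neg hne,
    if_neg hnil]

end IsGrowth

lemma verts_injective : Function.Injective verts := fun _ _ h => FamilyTree.ext h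

instance : Countable FamilyTree := verts_injective.countable

instance : DiscreteMeasurableSpace FamilyTree := ⟨fun _ => trivial⟩

lemma finite_setOf_isGrowth (T : FamilyTree) :
    {T' : FamilyTree | ∃ x ∈ T.verts, T.IsGrowth x T'}.Finite := by
  classical
  refine Set.Finite.of_finite_image (f := verts)
    ((T.verts.image fun x => insert (T.nextChild x) T.verts).finite_toSet.subset ?_)
    verts_injective.injOn
  rintro _ ⟨T', ⟨x, hx, h⟩, rfl⟩
  exact Finset.mem_coe.2 (Finset.mem_image.2 ⟨x, hx, h.symm⟩)

end FamilyTree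

/-! ### Ratios of Gamma functions -/

/-- The ratio `Γ(a + p) / Γ(a)`, which behaves like `a ^ p` for large `a`. -/
noncomputable def gammaRatio (a p : ℝ) : ℝ := Real.Gamma (a + p) / Real.Gamma a

lemma gammaRatio_pos {a p : ℝ} (ha : 0 < a) (hap : 0 < a + p) : 0 < gammaRatio a p :=
  div_pos (Real.Gamma_pos_of_pos hap) (Real.Gamma_pos_of_pos ha)

lemma gammaRatio_add_one {a p : ℝ} (ha : 0 < a) (hap : 0 < a + p) :
    gammaRatio (a + 1) p = gammaRatio a p * (1 + p / a) := by
  have h := Real.Gamma_pos_of_pos ha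
  rw [gammaRatio, gammaRatio, add_right_comm, Real.Gamma_add_one hap.ne', Real.Gamma_add_one ha.ne']
  field_simp

lemma gammaRatio_one {a : ℝ} (ha : 0 < a) : gammaRatio a 1 = a := by
  have h := Real.Gamma_pos_of_pos ha
  rw [gammaRatio, Real.Gamma_add_one ha.ne']
  field_simp

lemma Real.Gamma_add_nat_eq_prod {s : ℝ} (hs : 0 < s) (n : ℕ) :
    Real.Gamma (s + n) = Real.Gamma s * ∏ j ∈ Finset.range n, (s + j) := by
  induction n with
  | zero => simp
  | succ n ih =>
    rw [Nat.cast_succ, ← add_assoc, Real.Gamma_add_one (by positivity), ih,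
      Finset.prod_range_succ]
    ring

/-- Both Gamma functions are compared with Euler's sequence `n ^ s * n! / (s (s + 1) ⋯ (s + n))`. -/
lemma tendsto_gammaRatio_nat_add_of_pos {a p : ℝ} (ha : 0 < a) (hap : 0 < a + p) :
    Tendsto (fun n : ℕ => gammaRatio (n + a) p / (n : ℝ) ^ p) atTop (𝓝 1) := by
  have hΓ := Real.Gamma_pos_of_pos ha
  have hΓ' := Real.Gamma_pos_of_pos hap
  have h1 : Tendsto (fun n : ℕ => Real.Gamma (a + p) / Real.Gamma a *
      (Real.GammaSeq a n / Real.GammaSeq (a + p) n)) atTop (𝓝 1) := by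
    have := ((Real.GammaSeq_tendsto_Gamma a).div (Real.GammaSeq_tendsto_Gamma (a + p))
      hΓ'.ne').const_mul (Real.Gamma (a + p) / Real.Gamma a)
    rwa [div_mul_div_cancel₀ hΓ.ne', div_self hΓ'.ne'] at this
  have h2 : Tendsto (fun n : ℕ => 1 + p / ((n : ℝ) + a)) atTop (𝓝 1) := by
    have : Tendsto (fun n : ℕ => p / ((n : ℝ) + a)) atTop (𝓝 0) :=
      (tendsto_atTop_add_const_right _ a tendsto_natCast_atTop_atTop).const_div_atTop p
    simpa using this.const_add 1
  have h3 := h1.div h2 one_ne_zero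
  rw [div_one] at h3
  refine h3.congr' ?_
  filter_upwards [eventually_ge_atTop 1] with n hn
  have hn0 : (0 : ℝ) < n := by exact_mod_cast hn
  have hna : 0 < (n : ℝ) + a := by positivity
  have hnap : 0 < (n : ℝ) + a + p := by linarith
  have key : gammaRatio (n + a + 1) p = Real.Gamma (a + p) / Real.Gamma a *
      (Real.GammaSeq a n / Real.GammaSeq (a + p) n) * (n : ℝ) ^ p := by
    have e1 : (n : ℝ) + a + 1 = a + (n + 1 : ℕ) := by push_cast; ring
    have e2 : a + ((n + 1 : ℕ) : ℝ) + p = (a + p) + (n + 1 : ℕ) := by ring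
    have hp1 : 0 < ∏ j ∈ Finset.range (n + 1), (a + j) := Finset.prod_pos fun j _ => by positivity
    have hp2 : 0 < ∏ j ∈ Finset.range (n + 1), (a + p + j) :=
      Finset.prod_pos fun j _ => by positivity
    have hf : (0 : ℝ) < n.factorial := by exact_mod_cast n.factorial_pos
    have hpa : (0 : ℝ) < (n : ℝ) ^ a := Real.rpow_pos_of_pos hn0 a
    have hpp : (0 : ℝ) < (n : ℝ) ^ p := Real.rpow_pos_of_pos hn0 p
    rw [gammaRatio, e1, e2, Real.Gamma_add_nat_eq_prod ha, Real.Gamma_add_nat_eq_prod hap,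
      Real.GammaSeq, Real.GammaSeq, Real.rpow_add hn0]
    field_simp
  rw [gammaRatio_add_one hna hnap] at key
  have hpp : (0 : ℝ) < (n : ℝ) ^ p := Real.rpow_pos_of_pos hn0 p
  have hne : 1 + p / ((n : ℝ) + a) ≠ 0 := by
    have : 1 + p / ((n : ℝ) + a) = ((n : ℝ) + a + p) / (n + a) := by field_simp
    rw [this]; positivity
  simp only [Pi.div_apply]
  rw [div_eq_div_iff hne hpp.ne', ← key]

/-- The offset `k` allows for a negative `a`. -/
lemma tendsto_gammaRatio_nat_add {a p : ℝ} (k : ℕ) (ha : 0 < a + k) (hap : 0 < a + k + p) :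
    Tendsto (fun n : ℕ => gammaRatio (n + a) p / (n : ℝ) ^ p) atTop (𝓝 1) := by
  rw [← tendsto_add_atTop_iff_nat k]
  have h1 := tendsto_gammaRatio_nat_add_of_pos ha hap
  have h2 : Tendsto (fun n : ℕ => ((n : ℝ) / ((n : ℝ) + k)) ^ p) atTop (𝓝 1) := by
    have := (tendsto_natCast_div_add_atTop (𝕜 := ℝ) (k : ℝ)).rpow_const (p := p)
      (Or.inl one_ne_zero)
    simpa using this
  have h3 := h1.mul h2
  rw [one_mul] at h3
  refine h3.congr' ?_
  filter_upwards [eventually_ge_atTop 1] with n hn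
  have hn0 : (0 : ℝ) < n := by exact_mod_cast hn
  have hpp : (0 : ℝ) < (n : ℝ) ^ p := Real.rpow_pos_of_pos hn0 p
  have e : ((n + k : ℕ) : ℝ) + a = n + (a + k) := by push_cast; ring
  rw [e, Real.div_rpow hn0.le (by positivity), Nat.cast_add]
  field_simp

/-! ### The transition rule of the process -/

namespace IsPreferentialAttachmentTree

variable {Ω : Type*} {G : ℕ → Ω → FamilyTree}

/-- The history `(G₁, …, Gₙ)` of the process. -/
def history (G : ℕ → Ω → FamilyTree) (n : ℕ) (ω : Ω) : Finset.Icc 1 n → FamilyTree :=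
  fun i => G i ω

/-- The event that the process has the same history up to time `n` as at the sample point `ω`. -/
def historyEvent (G : ℕ → Ω → FamilyTree) (n : ℕ) (ω : Ω) : Set Ω :=
  {ω' | ∀ i ∈ Finset.Icc 1 n, G i ω' = G i ω}

lemma historyEvent_eq_preimage (n : ℕ) (ω : Ω) :
    historyEvent G n ω = history G n ⁻¹' {history G n ω} := by
  ext ω'
  simp [historyEvent, history, funext_iff]

variable [MeasurableSpace Ω] {μ : Measure Ω} {β : ℝ}

lemma measurable_history (hG : IsPreferentialAttachmentTree β μ G) (n : ℕ) :
    Measurable (history G n) :=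
  measurable_pi_lambda _ fun i => hG.measurable i (Finset.mem_Icc.1 i.2).1

/-- The filtration of the process: the `n`-th σ-algebra is generated by `G₁, …, Gₙ`. -/
def filtration (hG : IsPreferentialAttachmentTree β μ G) : Filtration ℕ ‹MeasurableSpace Ω› where
  seq n := MeasurableSpace.comap (history G n) inferInstance
  mono' m n hmn := by
    have : history G m = (fun (t : Finset.Icc 1 n → FamilyTree) (i : Finset.Icc 1 m) =>
        t ⟨i, Finset.mem_Icc.2 ⟨(Finset.mem_Icc.1 i.2).1, (Finset.mem_Icc.1 i.2).2.trans hmn⟩⟩) ∘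
        history G n := rfl
    dsimp only
    rw [this, ← MeasurableSpace.comap_comp]
    refine MeasurableSpace.comap_mono (Measurable.comap_le ?_)
    exact measurable_pi_lambda _ fun i => measurable_pi_apply _
  le' n := (hG.measurable_history n).comap_le

lemma measurable_filtration (hG : IsPreferentialAttachmentTree β μ G) {m n : ℕ} (hm : 1 ≤ m)
    (hmn : m ≤ n) : Measurable[hG.filtration n] (G m) :=
  (measurable_pi_apply (⟨m, Finset.mem_Icc.2 ⟨hm, hmn⟩⟩ : Finset.Icc 1 n)).comp
    (comap_measurable (history G n))

lemma measurableSet_historyEvent (hG : IsPreferentialAttachmentTree β μ G) (n : ℕ) (ω : Ω) :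
    MeasurableSet (historyEvent G n ω) := by
  rw [historyEvent_eq_preimage]
  exact hG.measurable_history n (MeasurableSet.singleton _)

lemma historyEvent_subset (hG : IsPreferentialAttachmentTree β μ G) {n : ℕ} {s : Set Ω}
    (hs : MeasurableSet[hG.filtration n] s) {ω : Ω} (hω : ω ∈ s) : historyEvent G n ω ⊆ s := by
  obtain ⟨B, -, rfl⟩ := hs
  intro ω' h
  rw [historyEvent_eq_preimage] at h
  simp only [Set.mem_preimage, Set.mem_singleton_iff] at h hω ⊢
  rwa [h]

/-- There are only countably many histories, so an almost sure property can be checked on each of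
those of positive probability. -/
lemma ae_of_forall_historyEvent {n : ℕ} {P : Ω → Prop}
    (h : ∀ ω, μ (historyEvent G n ω) ≠ 0 → ∀ᵐ ω' ∂μ, ω' ∈ historyEvent G n ω → P ω') :
    ∀ᵐ ω ∂μ, P ω := by
  have h1 : ∀ t : Finset.Icc 1 n → FamilyTree,
      ∀ᵐ ω ∂μ, history G n ω = t → P ω := by
    intro t
    by_cases ht : ∃ ω, history G n ω = t
    · obtain ⟨ω, rfl⟩ := ht
      by_cases h0 : μ (historyEvent G n ω) = 0
      · filter_upwards [measure_eq_zero_iff_ae_notMem.1 h0] with ω' hω' h'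
        exact absurd (by rw [historyEvent_eq_preimage]; exact h') hω'
      · filter_upwards [h ω h0] with ω' hω' h'
        exact hω' (by rw [historyEvent_eq_preimage]; exact h')
    · exact Eventually.of_forall fun ω hω => absurd ⟨ω, hω⟩ ht
  filter_upwards [ae_all_iff.2 h1] with ω hω
  exact hω _ rfl

/-- Two integrals over an event determined by `G₁, …, Gₙ` agree as soon as they agree over each
history of positive probability. -/
lemma setIntegral_eq_of_historyEvent (hG : IsPreferentialAttachmentTree β μ G) {n : ℕ}
    {f g : Ω → ℝ} (hf : Integrable f μ) (hg : Integrable g μ) {s : Set Ω}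
    (hs : MeasurableSet[hG.filtration n] s)
    (h : ∀ ω ∈ s, μ (historyEvent G n ω) ≠ 0 →
      ∫ ω' in historyEvent G n ω, f ω' ∂μ = ∫ ω' in historyEvent G n ω, g ω' ∂μ) :
    ∫ ω in s, f ω ∂μ = ∫ ω in s, g ω ∂μ := by
  have hcover : s = ⋃ t : Finset.Icc 1 n → FamilyTree, s ∩ history G n ⁻¹' {t} := by
    ext ω; simp
  have hm : ∀ t : Finset.Icc 1 n → FamilyTree, MeasurableSet (s ∩ history G n ⁻¹' {t}) := fun t =>
    (hG.filtration.le n _ hs).inter (hG.measurable_history n (MeasurableSet.singleton _))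
  have hd : Pairwise (Function.onFun Disjoint fun t => s ∩ history G n ⁻¹' {t}) := by
    intro t t' htt'
    refine Set.disjoint_left.2 ?_
    rintro ω ⟨-, h1⟩ ⟨-, h2⟩
    exact htt' (h1.symm.trans h2)
  rw [hcover, integral_iUnion hm hd hf.integrableOn, integral_iUnion hm hd hg.integrableOn]
  refine tsum_congr fun t => ?_
  rcases (s ∩ history G n ⁻¹' {t}).eq_empty_or_nonempty with he | ⟨ω, hωs, hωt⟩
  · simp [he]
  · have : s ∩ history G n ⁻¹' {t} = historyEvent G n ω := by
      have ht : history G n ⁻¹' {t} = historyEvent G n ω := by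
        rw [historyEvent_eq_preimage, ← hωt]
      rw [ht]
      exact Set.inter_eq_right.2 (hG.historyEvent_subset hs hωs)
    rw [this]
    by_cases h0 : μ (historyEvent G n ω) = 0
    · simp [Measure.restrict_eq_zero.2 h0]
    · exact h ω hωs h0

lemma measurableSet_isGrowth (hG : IsPreferentialAttachmentTree β μ G) {n : ℕ}
    (T : FamilyTree) (z : List ℕ+) : MeasurableSet {ω | T.IsGrowth z (G (n + 1) ω)} :=
  hG.measurable (n + 1) (by omega) (show MeasurableSet {T' | T.IsGrowth z T'} from trivial)

/-- The transition probabilities, with the conditioning on the history multiplied out. -/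
lemma measureReal_historyEvent_inter (hG : IsPreferentialAttachmentTree β μ G) {n : ℕ}
    (hn : 2 ≤ n) {ω : Ω} (h0 : μ (historyEvent G n ω) ≠ 0) {z : List ℕ+}
    (hz : z ∈ (G n ω).verts) [IsFiniteMeasure μ] :
    μ.real (historyEvent G n ω ∩ {ω' | (G n ω).IsGrowth z (G (n + 1) ω')}) =
      μ.real (historyEvent G n ω) *
        ((((G n ω).degree z : ℝ) + β) / (2 * (n : ℝ) - 2 + (n : ℝ) * β)) := by
  rw [← hG.step n hn (fun i => G i ω) h0 z hz]
  have := cond_mul_eq_inter' (hG.measurableSet_historyEvent n ω) (measure_ne_top μ _)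
    {ω' | (G n ω).IsGrowth z (G (n + 1) ω')} (μ := μ)
  rw [measureReal_def, measureReal_def, measureReal_def, ← this, ENNReal.toReal_mul, mul_comm]
  rfl

lemma sum_weights {β : ℝ} {n : ℕ} {T : FamilyTree} (hn : 1 ≤ n) (hT : T.verts.card = n) :
    ∑ z ∈ T.verts, ((T.degree z : ℝ) + β) = 2 * (n : ℝ) - 2 + (n : ℝ) * β := by
  rw [Finset.sum_add_distrib, ← Nat.cast_sum, T.sum_degree, hT, Finset.sum_const, hT]
  push_cast [Nat.cast_sub hn]
  simp
  ring

lemma total_weight_pos {β : ℝ} (hβ : -1 < β) {n : ℕ} (hn : 2 ≤ n) :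
    0 < 2 * (n : ℝ) - 2 + (n : ℝ) * β := by
  have : (2 : ℝ) ≤ n := by exact_mod_cast hn
  nlinarith

/-- The transition probabilities sum to `1` by the handshake lemma, so that almost surely `Gₙ₊₁`
arises from `Gₙ` by the attachment of a vertex. -/
lemma ae_isGrowth_of_card (hG : IsPreferentialAttachmentTree β μ G) (hβ : -1 < β)
    [IsFiniteMeasure μ] {n : ℕ} (hn : 2 ≤ n) (hc : ∀ᵐ ω ∂μ, (G n ω).verts.card = n) :
    ∀ᵐ ω ∂μ, ∃ z ∈ (G n ω).verts, (G n ω).IsGrowth z (G (n + 1) ω) := by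
  refine ae_of_forall_historyEvent (G := G) (n := n) fun ω h0 => ?_
  have hn' : n ∈ Finset.Icc 1 n := Finset.mem_Icc.2 ⟨by omega, le_rfl⟩
  set A := historyEvent G n ω with hA
  have hAm : MeasurableSet A := hG.measurableSet_historyEvent n ω
  have hT : (G n ω).verts.card = n := by
    by_contra hne
    refine h0 (measure_mono_null ?_ (ae_iff.1 hc))
    intro ω' hω'
    change ¬ _
    rwa [hω' n hn']
  set E : List ℕ+ → Set Ω := fun z => A ∩ {ω' | (G n ω).IsGrowth z (G (n + 1) ω')} with hE
  have hEm : ∀ z, MeasurableSet (E z) := fun z => hAm.inter (hG.measurableSet_isGrowth _ z)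
  have hsum : μ.real (⋃ z ∈ (G n ω).verts, E z) = μ.real A := by
    rw [measureReal_biUnion_finset]
    · rw [Finset.sum_congr rfl fun z hz => hG.measureReal_historyEvent_inter hn h0 hz,
        ← Finset.mul_sum, ← Finset.sum_div, sum_weights (by omega) hT,
        div_self (total_weight_pos hβ hn).ne', mul_one]
    · intro z _ z' _ hzz'
      refine Set.disjoint_left.2 ?_
      rintro ω' ⟨-, h1⟩ ⟨-, h2⟩
      exact hzz' (h1.eq_of_eq h2)
    · exact fun z _ => hEm z
  have hsub : (⋃ z ∈ (G n ω).verts, E z) ⊆ A := by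
    intro ω' h'
    simp only [Set.mem_iUnion] at h'
    obtain ⟨z, -, h1, -⟩ := h'
    exact h1
  have hdiff : μ (A \ ⋃ z ∈ (G n ω).verts, E z) = 0 := by
    rw [← measureReal_eq_zero_iff, measureReal_sdiff hsub
      (Finset.measurableSet_biUnion _ fun z _ => hEm z), hsum, sub_self]
  filter_upwards [measure_eq_zero_iff_ae_notMem.1 hdiff] with ω' h1 h2
  have h3 : ω' ∈ ⋃ z ∈ (G n ω).verts, E z := by
    by_contra h3
    exact h1 ⟨h2, h3⟩
  simp only [Set.mem_iUnion] at h3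
  obtain ⟨z, hz, -, h4⟩ := h3
  rw [h2 n hn']
  exact ⟨z, hz, h4⟩

lemma ae_card (hG : IsPreferentialAttachmentTree β μ G) (hβ : -1 < β) [IsFiniteMeasure μ]
    {n : ℕ} (hn : 2 ≤ n) : ∀ᵐ ω ∂μ, (G n ω).verts.card = n := by
  induction n, hn using Nat.le_induction with
  | base =>
    filter_upwards [hG.start, hG.first_step] with ω h1 h2
    rw [h2.card_eq, h1]
    rfl
  | succ n hn ih =>
    filter_upwards [ih, hG.ae_isGrowth_of_card hβ hn ih] with ω h1 ⟨z, _, h2⟩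
    rw [h2.card_eq, h1]

lemma ae_isGrowth (hG : IsPreferentialAttachmentTree β μ G) (hβ : -1 < β) [IsFiniteMeasure μ]
    {n : ℕ} (hn : 2 ≤ n) :
    ∀ᵐ ω ∂μ, ∃ z ∈ (G n ω).verts, (G n ω).IsGrowth z (G (n + 1) ω) :=
  hG.ae_isGrowth_of_card hβ hn (hG.ae_card hβ hn)

/-- `Gₙ` takes almost surely finitely many values, so that all functions of it are integrable. -/
lemma exists_finite_range (hG : IsPreferentialAttachmentTree β μ G) (hβ : -1 < β)
    [IsFiniteMeasure μ] {n : ℕ} (hn : 2 ≤ n) :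
    ∃ S : Set FamilyTree, S.Finite ∧ ∀ᵐ ω ∂μ, G n ω ∈ S := by
  induction n, hn using Nat.le_induction with
  | base =>
    refine ⟨_, ((Set.finite_singleton ({[], [1]} : Finset (List ℕ+))).preimage
      FamilyTree.verts_injective.injOn), ?_⟩
    filter_upwards [hG.start, hG.first_step] with ω h1 h2
    have hnc : (G 1 ω).numChildren [] = 0 := by
      by_contra hne
      have := ((G 1 ω).append_mem_iff [] 1).2 (by simpa using Nat.one_le_iff_ne_zero.2 hne)
      rw [h1] at this
      simp at this
    unfold FamilyTree.IsGrowth at h2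
    rw [FamilyTree.nextChild, hnc, h1] at h2
    rw [Set.mem_preimage, Set.mem_singleton_iff, h2, Finset.pair_comm]
    rfl
  | succ n hn ih =>
    obtain ⟨S, hS, h⟩ := ih
    refine ⟨_, hS.biUnion fun T _ => T.finite_setOf_isGrowth, ?_⟩
    filter_upwards [h, hG.ae_isGrowth hβ hn] with ω h1 h2
    exact Set.mem_biUnion h1 h2

lemma integrable_comp (hG : IsPreferentialAttachmentTree β μ G) (hβ : -1 < β)
    [IsFiniteMeasure μ] {n : ℕ} (hn : 2 ≤ n) (φ : FamilyTree → ℝ) :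
    Integrable (fun ω => φ (G n ω)) μ := by
  obtain ⟨S, hS, h⟩ := hG.exists_finite_range hβ hn
  obtain ⟨C, hC⟩ := (hS.image fun T => ‖φ T‖).bddAbove
  refine Integrable.of_bound (C := C)
    ((measurable_from_top (f := φ)).comp (hG.measurable n (by omega))).aestronglyMeasurable ?_
  filter_upwards [h] with ω hω
  exact hC ⟨_, hω, rfl⟩

/-- The transition rule of the process, in integrated form: if `Φ T z` is the value of `φ` after
growth of `T` at `z`, then the conditional expectation of `φ(Gₙ₊₁)` given `G₁, …, Gₙ` is
`∑ z, (deg (z, Gₙ) + β) / Sₙ * Φ Gₙ z`. -/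
lemma setIntegral_succ (hG : IsPreferentialAttachmentTree β μ G) (hβ : -1 < β)
    [IsFiniteMeasure μ] {n : ℕ} (hn : 2 ≤ n) {s : Set Ω} (hs : MeasurableSet[hG.filtration n] s)
    {φ : FamilyTree → ℝ} {Φ : FamilyTree → List ℕ+ → ℝ}
    (hΦ : ∀ ω ∈ s, ∀ T z, z ∈ (G n ω).verts → (G n ω).IsGrowth z T → φ T = Φ (G n ω) z) :
    ∫ ω in s, φ (G (n + 1) ω) ∂μ =
      ∫ ω in s, ∑ z ∈ (G n ω).verts, (((G n ω).degree z : ℝ) + β) /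
        (2 * (n : ℝ) - 2 + (n : ℝ) * β) * Φ (G n ω) z ∂μ := by
  classical
  refine hG.setIntegral_eq_of_historyEvent (hG.integrable_comp hβ (by omega) φ)
    (hG.integrable_comp hβ hn fun T => ∑ z ∈ T.verts, ((T.degree z : ℝ) + β) /
        (2 * (n : ℝ) - 2 + (n : ℝ) * β) * Φ T z) hs fun ω hω h0 => ?_
  have hn' : n ∈ Finset.Icc 1 n := Finset.mem_Icc.2 ⟨by omega, le_rfl⟩
  have hAm : MeasurableSet (historyEvent G n ω) := hG.measurableSet_historyEvent n ω
  have hR : ∀ ω' ∈ historyEvent G n ω, ∑ z ∈ (G n ω').verts, (((G n ω').degree z : ℝ) + β) /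
        (2 * (n : ℝ) - 2 + (n : ℝ) * β) * Φ (G n ω') z = ∑ z ∈ (G n ω).verts,
        (((G n ω).degree z : ℝ) + β) / (2 * (n : ℝ) - 2 + (n : ℝ) * β) * Φ (G n ω) z := by
    intro ω' h'
    rw [h' n hn']
  rw [setIntegral_congr_fun hAm hR, setIntegral_const, smul_eq_mul, Finset.mul_sum]
  have hL : ∀ᵐ ω' ∂μ, ω' ∈ historyEvent G n ω → φ (G (n + 1) ω') = ∑ z ∈ (G n ω).verts,
      {ω'' | (G n ω).IsGrowth z (G (n + 1) ω'')}.indicator (fun _ => Φ (G n ω) z) ω' := by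
    filter_upwards [hG.ae_isGrowth hβ hn] with ω' h1 h2
    rw [h2 n hn'] at h1
    obtain ⟨z, hz, hg⟩ := h1
    rw [Finset.sum_eq_single z]
    · rw [Set.indicator_of_mem (by exact hg)]
      exact hΦ ω hω _ z hz hg
    · intro z' _ hne
      rw [Set.indicator_of_notMem]
      exact fun h => hne (FamilyTree.IsGrowth.eq_of_eq h hg)
    · exact fun h => absurd hz h
  rw [setIntegral_congr_ae hAm hL, integral_finsetSum]
  · refine Finset.sum_congr rfl fun z hz => ?_
    rw [setIntegral_indicator (hG.measurableSet_isGrowth _ z), setIntegral_const, smul_eq_mul,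
      hG.measureReal_historyEvent_inter hn h0 hz, mul_assoc]
  · exact fun z _ => (integrable_const _).indicator (hG.measurableSet_isGrowth _ z)

end IsPreferentialAttachmentTree

/-! ### Moments of the degree and their normalization -/

/-- The function `d ↦ Γ(d + β + p) / Γ(d + β)` of the degree `d`, set to `0` at `d = 0`, which is
the degree of an absent vertex.  Its conditional expectation along the process grows by the
deterministic factor `1 + p / Sₙ`. -/
noncomputable def degreeMoment (β p : ℝ) (d : ℕ) : ℝ :=
  if d = 0 then 0 else gammaRatio (d + β) p

/-- The product `∏ (1 + p / Sₘ)` over `2 ≤ m < n`, up to a constant factor and in closed form. -/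
noncomputable def growthFactor (β p : ℝ) (n : ℕ) : ℝ :=
  gammaRatio (n - 2 / (2 + β)) (p / (2 + β))

section Analysis

variable {β p : ℝ}

lemma degreeMoment_zero : degreeMoment β p 0 = 0 := if_pos rfl

lemma degreeMoment_pos (hβ : -1 < β) (hp : -(1 + β) < p) {d : ℕ} (hd : 1 ≤ d) :
    0 < degreeMoment β p d := by
  have : (1 : ℝ) ≤ d := by exact_mod_cast hd
  rw [degreeMoment, if_neg (by omega)]
  exact gammaRatio_pos (by linarith) (by linarith)

lemma degreeMoment_nonneg (hβ : -1 < β) (hp : -(1 + β) < p) (d : ℕ) :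
    0 ≤ degreeMoment β p d := by
  rcases Nat.eq_zero_or_pos d with rfl | hd
  · exact degreeMoment_zero.ge
  · exact (degreeMoment_pos hβ hp hd).le

lemma degreeMoment_succ (hβ : -1 < β) (hp : -(1 + β) < p) {d : ℕ} (hd : 1 ≤ d) :
    degreeMoment β p (d + 1) = degreeMoment β p d * (1 + p / (d + β)) := by
  have : (1 : ℝ) ≤ d := by exact_mod_cast hd
  rw [degreeMoment, degreeMoment, if_neg (by omega), if_neg (by omega),
    ← gammaRatio_add_one (by linarith) (by linarith)]
  congr 1
  push_cast
  ring

lemma degreeMoment_one (hβ : -1 < β) {d : ℕ} (hd : 1 ≤ d) : degreeMoment β 1 d = d + β := by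
  have : (1 : ℝ) ≤ d := by exact_mod_cast hd
  rw [degreeMoment, if_neg (by omega), gammaRatio_one (by linarith)]

lemma tendsto_degreeMoment_div (hβ : -1 < β) (hp : -(1 + β) < p) :
    Tendsto (fun d : ℕ => degreeMoment β p d / (d : ℝ) ^ p) atTop (𝓝 1) := by
  refine (tendsto_gammaRatio_nat_add (a := β) (p := p) 1 ?_ ?_).congr' ?_
  · push_cast; linarith
  · push_cast; linarith
  · filter_upwards [eventually_ge_atTop 1] with d hd
    rw [degreeMoment, if_neg (by omega)]

lemma exists_rpow_le_degreeMoment (hβ : -1 < β) (hp : -(1 + β) < p) :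
    ∃ K : ℝ, 0 < K ∧ ∀ d : ℕ, 1 ≤ d → (d : ℝ) ^ p ≤ K * degreeMoment β p d := by
  obtain ⟨K, hK⟩ := ((tendsto_degreeMoment_div hβ hp).inv₀ one_ne_zero).bddAbove_range
  refine ⟨max K 1, by positivity, fun d hd => ?_⟩
  have h1 := hK ⟨d, rfl⟩
  have h2 := degreeMoment_pos hβ hp hd
  simp only [inv_div] at h1
  rw [div_le_iff₀ h2] at h1
  exact h1.trans (mul_le_mul_of_nonneg_right (le_max_left _ _) h2.le)

lemma exists_degreeMoment_le_rpow (hβ : -1 < β) (hp : -(1 + β) < p) :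
    ∃ K : ℝ, 0 < K ∧ ∀ d : ℕ, degreeMoment β p d ≤ K * (d : ℝ) ^ p := by
  obtain ⟨K, hK⟩ := (tendsto_degreeMoment_div hβ hp).bddAbove_range
  refine ⟨max K 1, by positivity, fun d => ?_⟩
  rcases Nat.eq_zero_or_pos d with rfl | hd
  · rw [degreeMoment_zero]; positivity
  · have h1 := hK ⟨d, rfl⟩
    have h2 : (0 : ℝ) < (d : ℝ) ^ p := Real.rpow_pos_of_pos (by exact_mod_cast hd) p
    simp only at h1
    rw [div_le_iff₀ h2] at h1
    exact h1.trans (mul_le_mul_of_nonneg_right (le_max_left _ _) h2.le)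

lemma growthFactor_args (hβ : -1 < β) (hp : -(1 + β) < p) {n : ℝ} (hn : 2 ≤ n) :
    0 < n - 2 / (2 + β) ∧ 0 < n - 2 / (2 + β) + p / (2 + β) := by
  have h2 : 0 < 2 + β := by linarith
  have e1 : n - 2 / (2 + β) = (n * (2 + β) - 2) / (2 + β) := by field_simp
  have e2 : n - 2 / (2 + β) + p / (2 + β) = (n * (2 + β) - 2 + p) / (2 + β) := by field_simp
  rw [e2, e1]
  exact ⟨div_pos (by nlinarith) h2, div_pos (by nlinarith) h2⟩

lemma growthFactor_pos (hβ : -1 < β) (hp : -(1 + β) < p) {n : ℕ} (hn : 2 ≤ n) :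
    0 < growthFactor β p n :=
  have h := growthFactor_args hβ hp (n := n) (by exact_mod_cast hn)
  gammaRatio_pos h.1 h.2

lemma growthFactor_succ (hβ : -1 < β) (hp : -(1 + β) < p) {n : ℕ} (hn : 2 ≤ n) :
    growthFactor β p (n + 1) =
      growthFactor β p n * (1 + p / (2 * (n : ℝ) - 2 + (n : ℝ) * β)) := by
  have h := growthFactor_args hβ hp (n := n) (by exact_mod_cast hn)
  have h2 : 0 < 2 + β := by linarith
  have hS := IsPreferentialAttachmentTree.total_weight_pos hβ hn
  have e : p / (2 * (n : ℝ) - 2 + (n : ℝ) * β) = p / (2 + β) / (n - 2 / (2 + β)) := by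
    rw [div_div]
    congr 1
    field_simp
    ring
  rw [growthFactor, growthFactor, e, ← gammaRatio_add_one h.1 h.2]
  congr 1
  push_cast
  ring

lemma tendsto_growthFactor_div (hβ : -1 < β) (hp : -(1 + β) < p) :
    Tendsto (fun n : ℕ => growthFactor β p n / (n : ℝ) ^ (p / (2 + β))) atTop (𝓝 1) := by
  have h := growthFactor_args hβ hp (n := (2 : ℕ)) (by norm_num)
  have := tendsto_gammaRatio_nat_add (a := -(2 / (2 + β))) (p := p / (2 + β)) 2
    (by linarith [h.1]) (by linarith [h.2])
  simpa only [growthFactor, ← sub_eq_add_neg] using this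

lemma growthFactor_le (hβ : -1 < β) (hp : -(1 + β) < p) :
    ∃ K : ℝ, 0 < K ∧ ∀ n : ℕ, 2 ≤ n → growthFactor β p n ≤ K * (n : ℝ) ^ (p / (2 + β)) := by
  obtain ⟨K, hK⟩ := (tendsto_growthFactor_div hβ hp).bddAbove_range
  refine ⟨max K 1, by positivity, fun n hn => ?_⟩
  have h1 := hK ⟨n, rfl⟩
  have h2 : (0 : ℝ) < (n : ℝ) ^ (p / (2 + β)) :=
    Real.rpow_pos_of_pos (by exact_mod_cast (by omega : 0 < n)) _
  simp only at h1
  rw [div_le_iff₀ h2] at h1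
  exact h1.trans (mul_le_mul_of_nonneg_right (le_max_left _ _) h2.le)

/-- Convergence of the normalized `degreeMoment` for the exponent `1` gives a limit of
`d n / n ^ (1 / (2 + β))`; convergence for a negative exponent prevents this limit from being
zero. -/
lemma exists_pos_limit (hβ : -1 < β) {d : ℕ → ℕ} (hd : ∀ᶠ n in atTop, 1 ≤ d n) {c c' : ℝ}
    (h1 : Tendsto (fun n => degreeMoment β 1 (d n) / growthFactor β 1 n) atTop (𝓝 c))
    (h2 : Tendsto (fun n => degreeMoment β (-((1 + β) / 2)) (d n) /
      growthFactor β (-((1 + β) / 2)) n) atTop (𝓝 c')) :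
    ∃ l : ℝ, 0 < l ∧
      Tendsto (fun n : ℕ => (d n : ℝ) / (n : ℝ) ^ (1 / (2 + β))) atTop (𝓝 l) := by
  have hb : 0 < 2 + β := by linarith
  -- any `ε` strictly between `0` and `1 + β` would do
  set ε := (1 + β) / 2 with hε
  have hε0 : 0 < ε := by rw [hε]; linarith
  have hlim : Tendsto (fun n : ℕ => (d n : ℝ) / (n : ℝ) ^ (1 / (2 + β))) atTop (𝓝 c) := by
    have h3 := h1.mul (tendsto_growthFactor_div hβ (p := 1) (by linarith))
    have h4 : Tendsto (fun n : ℕ => β / (n : ℝ) ^ (1 / (2 + β))) atTop (𝓝 0) :=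
      ((tendsto_rpow_atTop (by positivity)).comp tendsto_natCast_atTop_atTop).const_div_atTop β
    have h5 := h3.sub h4
    rw [mul_one, sub_zero] at h5
    refine h5.congr' ?_
    filter_upwards [hd, eventually_ge_atTop 2] with n hn hn2
    have := growthFactor_pos hβ (p := 1) (by linarith) hn2
    have : (0 : ℝ) < (n : ℝ) ^ (1 / (2 + β)) :=
      Real.rpow_pos_of_pos (by exact_mod_cast (by omega : 0 < n)) _
    rw [degreeMoment_one hβ hn]
    field_simp
    ring
  have hc : 0 ≤ c := ge_of_tendsto' hlim fun n => by positivity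
  refine ⟨c, lt_of_le_of_ne hc ?_, hlim⟩
  rintro rfl
  -- if the limit were `0`, the upper bound `K * (d n) ^ ε * degreeMoment β (-ε) (d n)` of `1`,
  -- in which the normalizations cancel, would tend to `0`
  obtain ⟨K, hK, hle⟩ := exists_rpow_le_degreeMoment hβ (p := -ε) (by linarith)
  have h3 := (h2.mul (tendsto_growthFactor_div hβ (p := -ε) (by linarith))).const_mul K
  have h4 := (hlim.rpow_const (p := ε) (Or.inr hε0.le)).mul h3
  rw [Real.zero_rpow hε0.ne', zero_mul] at h4
  refine absurd (ge_of_tendsto h4 (b := 1) ?_) (by norm_num)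
  filter_upwards [hd, eventually_ge_atTop 2] with n hn hn2
  have hn0 : (0 : ℝ) < n := by exact_mod_cast (by omega : 0 < n)
  have hd0 : (0 : ℝ) < d n := by exact_mod_cast hn
  have hg := growthFactor_pos hβ (p := -ε) (by linarith) hn2
  have hr : (0 : ℝ) < (n : ℝ) ^ (ε / (2 + β)) := Real.rpow_pos_of_pos hn0 _
  have hdε : (0 : ℝ) < (d n : ℝ) ^ ε := Real.rpow_pos_of_pos hd0 _
  have e : ((d n : ℝ) / (n : ℝ) ^ (1 / (2 + β))) ^ ε * (K * (degreeMoment β (-ε) (d n) /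
      growthFactor β (-ε) n * (growthFactor β (-ε) n / (n : ℝ) ^ (-ε / (2 + β))))) =
      (d n : ℝ) ^ ε * (K * degreeMoment β (-ε) (d n)) := by
    rw [Real.div_rpow hd0.le (by positivity), ← Real.rpow_mul hn0.le, neg_div,
      Real.rpow_neg hn0.le, one_div_mul_eq_div]
    field_simp
  rw [e]
  have h5 := mul_le_mul_of_nonneg_left (hle (d n) hn) hdε.le
  rwa [Real.rpow_neg hd0.le, mul_inv_cancel₀ hdε.ne'] at h5

end Analysis

/-! ### Almost sure convergence of the degrees -/

namespace IsPreferentialAttachmentTree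

variable {Ω : Type*} [MeasurableSpace Ω] {μ : Measure Ω} {β p : ℝ} {G : ℕ → Ω → FamilyTree}

/-- One step of growth multiplies the mean of `degreeMoment` of a present vertex by `1 + p / Sₙ`. -/
lemma sum_weights_mul_degreeMoment (hβ : -1 < β) (hp : -(1 + β) < p) {n : ℕ} (hn : 2 ≤ n)
    {T : FamilyTree} (hT : T.verts.card = n) {x : List ℕ+} (hx : x ∈ T.verts) :
    ∑ z ∈ T.verts, ((T.degree z : ℝ) + β) / (2 * (n : ℝ) - 2 + (n : ℝ) * β) *
        degreeMoment β p (T.degree x + if x = z then 1 else 0) =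
      (1 + p / (2 * (n : ℝ) - 2 + (n : ℝ) * β)) * degreeMoment β p (T.degree x) := by
  have hS := total_weight_pos hβ hn
  have hd := FamilyTree.degree_pos hx (hT ▸ hn)
  have hd' : (1 : ℝ) ≤ T.degree x := by exact_mod_cast hd
  have hsplit : ∀ z ∈ T.verts, ((T.degree z : ℝ) + β) / (2 * (n : ℝ) - 2 + (n : ℝ) * β) *
        degreeMoment β p (T.degree x + if x = z then 1 else 0) =
      ((T.degree z : ℝ) + β) / (2 * (n : ℝ) - 2 + (n : ℝ) * β) * degreeMoment β p (T.degree x) +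
      if x = z then ((T.degree x : ℝ) + β) / (2 * (n : ℝ) - 2 + (n : ℝ) * β) *
        (degreeMoment β p (T.degree x + 1) - degreeMoment β p (T.degree x)) else 0 := by
    intro z _
    split_ifs with h
    · subst h; ring
    · simp
  rw [Finset.sum_congr rfl hsplit, Finset.sum_add_distrib, Finset.sum_ite_eq, if_pos hx,
    ← Finset.sum_mul, ← Finset.sum_div, sum_weights (by omega) hT, div_self hS.ne',
    degreeMoment_succ hβ hp hd]
  have : 0 < (T.degree x : ℝ) + β := by linarith
  field_simp
  ring

lemma setIntegral_degreeMoment_succ (hG : IsPreferentialAttachmentTree β μ G) (hβ : -1 < β)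
    [IsFiniteMeasure μ] (hp : -(1 + β) < p) {n : ℕ} (hn : 2 ≤ n) {x : List ℕ+} {s : Set Ω}
    (hs : MeasurableSet[hG.filtration n] s) (hsx : ∀ ω ∈ s, x ∈ (G n ω).verts) :
    ∫ ω in s, degreeMoment β p ((G (n + 1) ω).degree x) ∂μ =
      (1 + p / (2 * (n : ℝ) - 2 + (n : ℝ) * β)) *
        ∫ ω in s, degreeMoment β p ((G n ω).degree x) ∂μ := by
  rw [hG.setIntegral_succ hβ hn hs (φ := fun T => degreeMoment β p (T.degree x))
    (Φ := fun T z => degreeMoment β p (T.degree x + if x = z then 1 else 0)),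
    ← integral_const_mul]
  · refine setIntegral_congr_ae (hG.filtration.le n _ hs) ?_
    filter_upwards [hG.ae_card hβ hn] with ω hc hω
    exact sum_weights_mul_degreeMoment hβ hp hn hc (hsx ω hω)
  · intro ω hω T z _ hT
    rw [hT.degree_of_mem (hsx ω hω)]

lemma ae_mono (hG : IsPreferentialAttachmentTree β μ G) (hβ : -1 < β) [IsFiniteMeasure μ] :
    ∀ᵐ ω ∂μ, ∀ m n : ℕ, 2 ≤ m → m ≤ n → (G m ω).verts ⊆ (G n ω).verts := by
  have h : ∀ᵐ ω ∂μ, ∀ n : ℕ, 2 ≤ n → (G n ω).verts ⊆ (G (n + 1) ω).verts := by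
    rw [ae_all_iff]
    intro n
    by_cases hn : 2 ≤ n
    · filter_upwards [hG.ae_isGrowth hβ hn] with ω ⟨z, _, hz⟩ _
      exact hz.subset
    · exact Eventually.of_forall fun ω h => absurd h hn
  filter_upwards [h] with ω hω m n hm hmn
  induction n, hmn using Nat.le_induction with
  | base => exact subset_rfl
  | succ n hmn ih => exact ih.trans (hω n (hm.trans hmn))

lemma ae_card_all (hG : IsPreferentialAttachmentTree β μ G) (hβ : -1 < β) [IsFiniteMeasure μ] :
    ∀ᵐ ω ∂μ, ∀ n : ℕ, 2 ≤ n → (G n ω).verts.card = n := by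
  rw [ae_all_iff]
  intro n
  by_cases hn : 2 ≤ n
  · filter_upwards [hG.ae_card hβ hn] with ω h _ using h
  · exact Eventually.of_forall fun ω h => absurd h hn

/-- The filtration of the process from time `m` on. -/
def filtrationFrom (hG : IsPreferentialAttachmentTree β μ G) (m : ℕ) :
    Filtration ℕ ‹MeasurableSpace Ω› where
  seq i := hG.filtration (m + i)
  mono' _ _ hij := hG.filtration.mono (by omega)
  le' i := hG.filtration.le (m + i)

lemma measurableSet_mem_verts (hG : IsPreferentialAttachmentTree β μ G) {m n : ℕ} (hm : 1 ≤ m)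
    (hmn : m ≤ n) (x : List ℕ+) : MeasurableSet[hG.filtration n] {ω | x ∈ (G m ω).verts} :=
  hG.measurable_filtration hm hmn (show MeasurableSet {T : FamilyTree | x ∈ T.verts} from trivial)

/-- The restriction to the event that `x` is present at time `m` avoids the jump at its birth. -/
lemma martingale_degreeMoment (hG : IsPreferentialAttachmentTree β μ G) (hβ : -1 < β)
    [IsFiniteMeasure μ] (hp : -(1 + β) < p) {m : ℕ} (hm : 2 ≤ m) (x : List ℕ+) :
    Martingale (fun i => {ω | x ∈ (G m ω).verts}.indicator
      fun ω => degreeMoment β p ((G (m + i) ω).degree x) / growthFactor β p (m + i))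
      (hG.filtrationFrom m) μ := by
  have hB : ∀ i, MeasurableSet[hG.filtration (m + i)] {ω | x ∈ (G m ω).verts} :=
    fun i => hG.measurableSet_mem_verts (by omega) (by omega) x
  have hB' : MeasurableSet {ω | x ∈ (G m ω).verts} := hG.filtration.le _ _ (hB 0)
  refine martingale_of_setIntegral_eq_succ ?_ ?_ ?_
  · intro i
    refine Measurable.stronglyMeasurable (Measurable.indicator ?_ (hB i))
    exact (measurable_from_top (f := fun T : FamilyTree =>
      degreeMoment β p (T.degree x) / growthFactor β p (m + i))).comp
      (hG.measurable_filtration (by omega) le_rfl)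
  · intro i
    exact (hG.integrable_comp hβ (by omega) fun T =>
      degreeMoment β p (T.degree x) / growthFactor β p (m + i)).indicator hB'
  · intro i s hs
    have hmi : 2 ≤ m + i := by omega
    have hs' : MeasurableSet[hG.filtration (m + i)] s := hs
    rw [setIntegral_indicator hB', setIntegral_indicator hB', integral_div, integral_div,
      ← add_assoc]
    have h0 : ∀ᵐ ω ∂μ, ω ∈ s ∩ {ω | x ∈ (G m ω).verts} ↔ ω ∈ (s ∩ {ω | x ∈ (G m ω).verts}) ∩
        {ω | x ∈ (G (m + i) ω).verts} := by
      filter_upwards [hG.ae_mono hβ] with ω hω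
      constructor
      · rintro ⟨h1, h2⟩
        exact ⟨⟨h1, h2⟩, hω m (m + i) hm (by omega) h2⟩
      · exact fun h => h.1
    have h0' : (s ∩ {ω | x ∈ (G m ω).verts} : Set Ω) =ᵐ[μ]
        ((s ∩ {ω | x ∈ (G m ω).verts}) ∩ {ω | x ∈ (G (m + i) ω).verts} : Set Ω) := by
      filter_upwards [h0] with ω hω using propext hω
    rw [setIntegral_congr_set h0', setIntegral_congr_set h0',
      hG.setIntegral_degreeMoment_succ hβ hp hmi (x := x)
      ((hs'.inter (hB i)).inter (hG.measurableSet_mem_verts (by omega) le_rfl x))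
      fun ω hω => hω.2, growthFactor_succ hβ hp hmi]
    have hg := growthFactor_pos hβ hp hmi
    have hg' := growthFactor_pos hβ hp (show 2 ≤ m + i + 1 by omega)
    rw [growthFactor_succ hβ hp hmi] at hg'
    have hf := pos_of_mul_pos_right hg' hg.le
    rw [mul_comm (growthFactor β p (m + i)), mul_div_mul_left _ _ hf.ne']

lemma ae_exists_tendsto_degreeMoment (hG : IsPreferentialAttachmentTree β μ G) (hβ : -1 < β)
    [IsFiniteMeasure μ] (hp : -(1 + β) < p) {m : ℕ} (hm : 2 ≤ m) (x : List ℕ+) :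
    ∀ᵐ ω ∂μ, x ∈ (G m ω).verts → ∃ c, Tendsto
      (fun n => degreeMoment β p ((G n ω).degree x) / growthFactor β p n) atTop (𝓝 c) := by
  have hM := hG.martingale_degreeMoment hβ hp hm x
  set X : ℕ → Ω → ℝ := fun i => {ω | x ∈ (G m ω).verts}.indicator
      fun ω => degreeMoment β p ((G (m + i) ω).degree x) / growthFactor β p (m + i) with hX
  have hnn : ∀ i ω, 0 ≤ X i ω := fun i => Set.indicator_nonneg fun ω _ =>
    div_nonneg (degreeMoment_nonneg hβ hp _) (growthFactor_pos hβ hp (by omega)).le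
  have hbdd : ∀ i, eLpNorm (X i) 1 μ ≤ (∫ ω, X 0 ω ∂μ).toNNReal := by
    intro i
    have h1 : ∫ ω, X i ω ∂μ = ∫ ω, X 0 ω ∂μ := by
      have := hM.setIntegral_eq (Nat.zero_le i) (MeasurableSet.univ)
      simpa using this.symm
    rw [eLpNorm_one_eq_lintegral_enorm, ← h1, ← ENNReal.ofReal,
      ofReal_integral_eq_lintegral_ofReal (hM.integrable i) (Eventually.of_forall (hnn i))]
    refine le_of_eq (lintegral_congr fun ω => ?_)
    rw [Real.enorm_eq_ofReal (hnn i ω)]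
  filter_upwards [hM.submartingale.exists_ae_tendsto_of_bdd hbdd] with ω ⟨c, hc⟩ hω
  refine ⟨c, (tendsto_add_atTop_iff_nat m).1 (hc.congr fun i => ?_)⟩
  rw [hX, add_comm i m]
  exact Set.indicator_of_mem (by exact hω) _

lemma ae_exists_pos_limit_of_mem (hG : IsPreferentialAttachmentTree β μ G) (hβ : -1 < β)
    [IsFiniteMeasure μ] (x : List ℕ+) :
    ∀ᵐ ω ∂μ, (∃ m, 2 ≤ m ∧ x ∈ (G m ω).verts) → ∃ l : ℝ, 0 < l ∧
      Tendsto (fun n : ℕ => ((G n ω).degree x : ℝ) / (n : ℝ) ^ (1 / (2 + β))) atTop (𝓝 l) := by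
  have key : ∀ᵐ ω ∂μ, ∀ m, 2 ≤ m → x ∈ (G m ω).verts → ∃ l : ℝ, 0 < l ∧
      Tendsto (fun n : ℕ => ((G n ω).degree x : ℝ) / (n : ℝ) ^ (1 / (2 + β))) atTop (𝓝 l) := by
    rw [ae_all_iff]
    intro m
    by_cases hm : 2 ≤ m
    · filter_upwards [hG.ae_exists_tendsto_degreeMoment hβ (p := 1) (by linarith) hm x,
        hG.ae_exists_tendsto_degreeMoment hβ (p := -((1 + β) / 2)) (by linarith) hm x,
        hG.ae_mono hβ, hG.ae_card_all hβ] with ω h1 h2 h3 h4 _ hx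
      obtain ⟨c, hc⟩ := h1 hx
      obtain ⟨c', hc'⟩ := h2 hx
      refine exists_pos_limit hβ ?_ hc hc'
      filter_upwards [eventually_ge_atTop m] with n hn
      exact FamilyTree.degree_pos (h3 m n hm hn hx) (by rw [h4 n (by omega)]; omega)
    · exact Eventually.of_forall fun ω h => absurd h hm
  filter_upwards [key] with ω hω ⟨m, hm, hx⟩
  exact hω m hm hx

/-- Almost surely every vertex is born: the degree of its parent tends to infinity. -/
lemma ae_exists_mem_verts (hG : IsPreferentialAttachmentTree β μ G) (hβ : -1 < β)
    [IsFiniteMeasure μ] (x : List ℕ+) : ∀ᵐ ω ∂μ, ∃ m, 2 ≤ m ∧ x ∈ (G m ω).verts := by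
  induction x using List.reverseRecOn with
  | nil => exact Eventually.of_forall fun ω => ⟨2, le_rfl, (G 2 ω).root_mem⟩
  | append_singleton y j ih =>
    filter_upwards [ih, hG.ae_exists_pos_limit_of_mem hβ y, hG.ae_mono hβ] with ω h1 h2 h3
    obtain ⟨l, hl, hlim⟩ := h2 h1
    obtain ⟨m, hm, hy⟩ := h1
    have hb : 0 < 2 + β := by linarith
    have hpow : Tendsto (fun n : ℕ => (n : ℝ) ^ (1 / (2 + β))) atTop atTop :=
      (tendsto_rpow_atTop (by positivity)).comp tendsto_natCast_atTop_atTop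
    have hdeg : Tendsto (fun n : ℕ => ((G n ω).degree y : ℝ)) atTop atTop := by
      refine (hlim.pos_mul_atTop hl hpow).congr' ?_
      filter_upwards [eventually_ge_atTop 1] with n hn
      have : (0 : ℝ) < (n : ℝ) ^ (1 / (2 + β)) :=
        Real.rpow_pos_of_pos (by exact_mod_cast (by omega : 0 < n)) _
      field_simp
    obtain ⟨n, hn1, hn2⟩ := ((hdeg.eventually_ge_atTop ((j : ℕ) + 1 : ℝ)).and
      (eventually_ge_atTop m)).exists
    refine ⟨n, by omega, ?_⟩
    rw [FamilyTree.append_mem_iff]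
    have h4 := FamilyTree.degree_of_mem (h3 m n hm hn2 hy)
    have h5 : (j : ℕ) + 1 ≤ (G n ω).degree y := by exact_mod_cast hn1
    split_ifs at h4 <;> omega

lemma ae_eventually_mem_verts (hG : IsPreferentialAttachmentTree β μ G) (hβ : -1 < β)
    [IsFiniteMeasure μ] (x : List ℕ+) : ∀ᵐ ω ∂μ, ∀ᶠ n in atTop, x ∈ (G n ω).verts := by
  filter_upwards [hG.ae_exists_mem_verts hβ x, hG.ae_mono hβ] with ω ⟨m, hm, hx⟩ h
  filter_upwards [eventually_ge_atTop m] with n hn using h m n hm hn hx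

lemma exists_limit (hG : IsPreferentialAttachmentTree β μ G) (hβ : -1 < β)
    [IsFiniteMeasure μ] (x : List ℕ+) :
    ∃ ζ : Ω → ℝ, Measurable ζ ∧ (∀ ω, 0 < ζ ω) ∧
      (∀ᵐ ω ∂μ, Tendsto (fun n : ℕ => ((G n ω).degree x : ℝ) / (n : ℝ) ^ (1 / (2 + β)))
        atTop (𝓝 (ζ ω))) := by
  have h : ∀ᵐ ω ∂μ, ∃ l : ℝ, 0 < l ∧
      Tendsto (fun n : ℕ => ((G n ω).degree x : ℝ) / (n : ℝ) ^ (1 / (2 + β))) atTop (𝓝 l) := by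
    filter_upwards [hG.ae_exists_mem_verts hβ x, hG.ae_exists_pos_limit_of_mem hβ x] with ω h1 h2
    exact h2 h1
  -- `G 0` need not be measurable, hence the shift
  obtain ⟨ζ, hζ, hlim⟩ := measurable_limit_of_tendsto_metrizable_ae (μ := μ) (L := atTop)
    (f := fun (n : ℕ) ω => ((G (n + 1) ω).degree x : ℝ) / ((n + 1 : ℕ) : ℝ) ^ (1 / (2 + β)))
    (fun n => ((measurable_from_top (f := fun T : FamilyTree =>
      (T.degree x : ℝ) / ((n + 1 : ℕ) : ℝ) ^ (1 / (2 + β)))).comp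
      (hG.measurable (n + 1) (by omega))).aemeasurable) (by
      filter_upwards [h] with ω ⟨l, _, hl⟩
      exact ⟨l, (tendsto_add_atTop_iff_nat (f := fun n : ℕ =>
        ((G n ω).degree x : ℝ) / (n : ℝ) ^ (1 / (2 + β))) 1).2 hl⟩)
  refine ⟨fun ω => if 0 < ζ ω then ζ ω else 1,
    Measurable.ite (measurableSet_lt measurable_const hζ) hζ measurable_const, fun ω => ?_, ?_⟩
  · dsimp only
    split_ifs with h
    · exact h
    · exact one_pos
  · filter_upwards [h, hlim] with ω ⟨l, hl, hl'⟩ h2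
    have h3 := (tendsto_add_atTop_iff_nat (f := fun n : ℕ =>
        ((G n ω).degree x : ℝ) / (n : ℝ) ^ (1 / (2 + β))) 1).1 h2
    obtain rfl := tendsto_nhds_unique hl' h3
    rwa [if_pos hl]

end IsPreferentialAttachmentTree

/-! ### Comparison of the moments of a vertex and of its parent -/

/-- Nonnegative random variables bounded in `L²` are uniformly integrable, so that their
expectations converge along with them. -/
lemma tendsto_integral_of_integral_sq_le {Ω : Type*} [MeasurableSpace Ω] {μ : Measure Ω}
    [IsFiniteMeasure μ] {X : ℕ → Ω → ℝ} {Y : Ω → ℝ} (hX : ∀ n, Measurable (X n))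
    (hnn : ∀ n ω, 0 ≤ X n ω) (hint : ∀ n, Integrable (fun ω => X n ω ^ 2) μ) {C : ℝ}
    (hC : ∀ n, ∫ ω, X n ω ^ 2 ∂μ ≤ C)
    (hlim : ∀ᵐ ω ∂μ, Tendsto (fun n => X n ω) atTop (𝓝 (Y ω))) :
    Integrable Y μ ∧ Tendsto (fun n => ∫ ω, X n ω ∂μ) atTop (𝓝 (∫ ω, Y ω ∂μ)) := by
  have hC0 : 0 ≤ C := (integral_nonneg fun ω => sq_nonneg (X 0 ω)).trans (hC 0)
  have hui : UniformIntegrable X 1 μ := by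
    refine uniformIntegrable_of le_rfl ENNReal.one_ne_top
      (fun n => (hX n).aestronglyMeasurable) fun ε hε => ?_
    have hK : 0 < (C + 1) / ε := by positivity
    refine ⟨((C + 1) / ε).toNNReal, fun n => ?_⟩
    rw [eLpNorm_one_eq_lintegral_enorm]
    calc ∫⁻ ω, ‖{ω | ((C + 1) / ε).toNNReal ≤ ‖X n ω‖₊}.indicator (X n) ω‖ₑ ∂μ
        ≤ ∫⁻ ω, ENNReal.ofReal (X n ω ^ 2 * (ε / (C + 1))) ∂μ := by
          refine lintegral_mono fun ω => ?_
          by_cases h : ω ∈ {ω | ((C + 1) / ε).toNNReal ≤ ‖X n ω‖₊}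
          · rw [Set.indicator_of_mem h, Real.enorm_eq_ofReal (hnn n ω)]
            refine ENNReal.ofReal_le_ofReal ?_
            have h' : (C + 1) / ε ≤ X n ω := by
              have h1 : ((C + 1) / ε).toNNReal ≤ ‖X n ω‖₊ := h
              rw [Real.toNNReal_le_iff_le_coe, coe_nnnorm, Real.norm_of_nonneg (hnn n ω)] at h1
              exact h1
            rw [div_le_iff₀ hε] at h'
            rw [← mul_div_assoc, le_div_iff₀ (by positivity)]
            nlinarith [hnn n ω]
          · rw [Set.indicator_of_notMem h, enorm_zero]
            exact zero_le
      _ = ENNReal.ofReal (∫ ω, X n ω ^ 2 * (ε / (C + 1)) ∂μ) := by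
          rw [ofReal_integral_eq_lintegral_ofReal ((hint n).mul_const _)]
          exact Eventually.of_forall fun ω => by positivity
      _ ≤ ENNReal.ofReal ε := by
          refine ENNReal.ofReal_le_ofReal ?_
          rw [integral_mul_const, ← mul_div_assoc, div_le_iff₀ (by positivity)]
          nlinarith [hC n]
  have hY : MemLp Y 1 μ := hui.memLp_of_ae_tendsto hlim
  have hL1 := tendsto_Lp_finite_of_tendsto_ae le_rfl ENNReal.one_ne_top
    (fun n => (hX n).aestronglyMeasurable) hY hui.unifIntegrable hlim
  exact ⟨memLp_one_iff_integrable.1 hY, tendsto_integral_of_L1' Y hY.1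
    (Eventually.of_forall fun n => memLp_one_iff_integrable.1 (hui.memLp n)) hL1⟩

lemma exists_degreeMoment_sq_le {β p : ℝ} (hβ : -1 < β) (hp : 0 ≤ p) :
    ∃ K : ℝ, 0 < K ∧ ∀ d : ℕ, degreeMoment β p d ^ 2 ≤ K * degreeMoment β (2 * p) d := by
  obtain ⟨K, hK, h1⟩ := exists_degreeMoment_le_rpow hβ (p := p) (by linarith)
  obtain ⟨K', hK', h2⟩ := exists_rpow_le_degreeMoment hβ (p := 2 * p) (by linarith)
  refine ⟨K ^ 2 * K', by positivity, fun d => ?_⟩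
  rcases Nat.eq_zero_or_pos d with rfl | hd
  · simp [degreeMoment_zero]
  · have h3 : ((d : ℝ) ^ p) ^ 2 = (d : ℝ) ^ (2 * p) := by
      rw [mul_comm, Real.rpow_mul (Nat.cast_nonneg d), Real.rpow_two]
    calc degreeMoment β p d ^ 2 ≤ (K * (d : ℝ) ^ p) ^ 2 :=
          pow_le_pow_left₀ (degreeMoment_nonneg hβ (by linarith) d) (h1 d) 2
      _ = K ^ 2 * (d : ℝ) ^ (2 * p) := by rw [mul_pow, h3]
      _ ≤ K ^ 2 * (K' * degreeMoment β (2 * p) d) :=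
          mul_le_mul_of_nonneg_left (h2 d hd) (by positivity)
      _ = _ := by ring

/-- The degree that the vertex `y` has just after the birth of its `j`-th child. -/
def degreeAtBirth (y : List ℕ+) (j : ℕ+) : ℕ := j + if y = [] then 0 else 1

lemma one_le_degreeAtBirth (y : List ℕ+) (j : ℕ+) : 1 ≤ degreeAtBirth y j :=
  (show 1 ≤ (j : ℕ) from j.pos).trans (Nat.le_add_right _ _)

open Classical in
/-- The combination of the `degreeMoment`s of a vertex `y` and of its `j`-th child which vanishes
at the birth of this child. -/
noncomputable def familyMoment (β p : ℝ) (y : List ℕ+) (j : ℕ+) (T : FamilyTree) : ℝ :=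
  if y ++ [j] ∈ T.verts then
    degreeMoment β p 1 * degreeMoment β p (T.degree y) -
      degreeMoment β p (degreeAtBirth y j) * degreeMoment β p (T.degree (y ++ [j]))
  else 0

lemma FamilyTree.IsGrowth.familyMoment_eq_zero {β p : ℝ} {T T' : FamilyTree} {z : List ℕ+}
    (h : T.IsGrowth z T') (hz : z ∈ T.verts) {y : List ℕ+} {j : ℕ+} (hx : y ++ [j] ∉ T.verts) :
    familyMoment β p y j T' = 0 := by
  rw [familyMoment]
  split_ifs with hx'
  · obtain ⟨h1, h2⟩ := h.degree_of_notMem hx hx'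
    have hyz : y = z := by
      have := congrArg List.dropLast h2
      simpa [FamilyTree.nextChild] using this
    subst hyz
    have hj : j = (T.numChildren y).succPNat := by
      simpa [FamilyTree.nextChild] using h2
    have hj' : (j : ℕ) = T.numChildren y + 1 := by rw [hj]; rfl
    have h3 : T'.degree y = degreeAtBirth y j := by
      rw [h.degree_of_mem hz, if_pos rfl, FamilyTree.degree_of_mem hz, degreeAtBirth, hj']
      ring
    rw [h1, h3]
    ring
  · rfl

namespace IsPreferentialAttachmentTree

variable {Ω : Type*} [MeasurableSpace Ω] {μ : Measure Ω} {β p : ℝ} {G : ℕ → Ω → FamilyTree}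

/-- The birth of the child does not contribute, and both terms grow by the same factor. -/
lemma integral_familyMoment (hG : IsPreferentialAttachmentTree β μ G) (hβ : -1 < β)
    [IsFiniteMeasure μ] (hp : -(1 + β) < p) (y : List ℕ+) (j : ℕ+) {n : ℕ} (hn : 2 ≤ n) :
    ∫ ω, familyMoment β p y j (G n ω) ∂μ = 0 := by
  classical
  induction n, hn using Nat.le_induction with
  | base =>
    rw [← integral_zero Ω ℝ (μ := μ)]
    refine integral_congr_ae ?_
    filter_upwards [hG.start, hG.first_step] with ω h1 h2
    refine h2.familyMoment_eq_zero (G 1 ω).root_mem ?_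
    rw [h1]
    simp
  | succ n hn ih =>
    have h := hG.setIntegral_succ hβ hn (s := Set.univ) MeasurableSet.univ
      (φ := familyMoment β p y j)
      (Φ := fun T z => if y ++ [j] ∈ T.verts then
        degreeMoment β p 1 * degreeMoment β p (T.degree y + if y = z then 1 else 0) -
          degreeMoment β p (degreeAtBirth y j) *
            degreeMoment β p (T.degree (y ++ [j]) + if y ++ [j] = z then 1 else 0)
        else 0) ?_
    · simp only [setIntegral_univ] at h
      rw [h]
      have h2 : ∀ᵐ ω ∂μ, ∑ z ∈ (G n ω).verts, (((G n ω).degree z : ℝ) + β) /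
          (2 * (n : ℝ) - 2 + (n : ℝ) * β) * (if y ++ [j] ∈ (G n ω).verts then
        degreeMoment β p 1 * degreeMoment β p ((G n ω).degree y + if y = z then 1 else 0) -
          degreeMoment β p (degreeAtBirth y j) *
            degreeMoment β p ((G n ω).degree (y ++ [j]) + if y ++ [j] = z then 1 else 0)
        else 0) = (1 + p / (2 * (n : ℝ) - 2 + (n : ℝ) * β)) * familyMoment β p y j (G n ω) := by
        filter_upwards [hG.ae_card hβ hn] with ω hc
        by_cases hx : y ++ [j] ∈ (G n ω).verts
        · have hy := (G n ω).parent_mem y j hx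
          have e1 := sum_weights_mul_degreeMoment hβ hp hn hc hx
          have e2 := sum_weights_mul_degreeMoment hβ hp hn hc hy
          simp only [if_pos hx, familyMoment]
          rw [mul_sub, mul_left_comm _ (degreeMoment β p 1), mul_left_comm _
            (degreeMoment β p (degreeAtBirth y j)), ← e1, ← e2, Finset.mul_sum, Finset.mul_sum,
            ← Finset.sum_sub_distrib]
          refine Finset.sum_congr rfl fun z _ => ?_
          ring
        · simp [if_neg hx, familyMoment]
      rw [integral_congr_ae h2, integral_const_mul, ih, mul_zero]
    · intro ω _ T z hz hT
      by_cases hx : y ++ [j] ∈ (G n ω).verts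
      · have hy := (G n ω).parent_mem y j hx
        simp only [familyMoment, if_pos hx, if_pos (hT.subset hx)]
        rw [hT.degree_of_mem hx, hT.degree_of_mem hy]
      · simp only [if_neg hx]
        exact hT.familyMoment_eq_zero hz hx

lemma integral_degreeMoment_child (hG : IsPreferentialAttachmentTree β μ G) (hβ : -1 < β)
    [IsFiniteMeasure μ] (hp : -(1 + β) < p) (y : List ℕ+) (j : ℕ+) {n : ℕ} (hn : 2 ≤ n) :
    degreeMoment β p (degreeAtBirth y j) *
        ∫ ω, degreeMoment β p ((G n ω).degree (y ++ [j])) ∂μ =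
      degreeMoment β p 1 * ∫ ω, {ω | y ++ [j] ∈ (G n ω).verts}.indicator
        (fun ω => degreeMoment β p ((G n ω).degree y)) ω ∂μ := by
  classical
  have h := hG.integral_familyMoment hβ hp y j hn
  have e : ∀ ω, familyMoment β p y j (G n ω) =
      degreeMoment β p 1 * {ω | y ++ [j] ∈ (G n ω).verts}.indicator
        (fun ω => degreeMoment β p ((G n ω).degree y)) ω -
      degreeMoment β p (degreeAtBirth y j) * degreeMoment β p ((G n ω).degree (y ++ [j])) := by
    intro ω
    by_cases hx : y ++ [j] ∈ (G n ω).verts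
    · rw [Set.indicator_of_mem (by exact hx), familyMoment, if_pos hx]
    · rw [Set.indicator_of_notMem (by exact hx), familyMoment, if_neg hx,
        FamilyTree.degree_of_notMem hx, degreeMoment_zero]
      ring
  have hi : Integrable (fun ω => {ω | y ++ [j] ∈ (G n ω).verts}.indicator
      (fun ω => degreeMoment β p ((G n ω).degree y)) ω) μ :=
    (hG.integrable_comp hβ hn fun T => degreeMoment β p (T.degree y)).indicator
      (hG.filtration.le n _ (hG.measurableSet_mem_verts (by omega) le_rfl _))
  simp only [e] at h
  rw [integral_sub (hi.const_mul _) ((hG.integrable_comp hβ hn fun T =>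
    degreeMoment β p (T.degree (y ++ [j]))).const_mul _), integral_const_mul,
    integral_const_mul, sub_eq_zero] at h
  exact h.symm

/-- The moments of the degree are of order at most `growthFactor`, by induction along the vertex. -/
lemma exists_integral_degreeMoment_le (hG : IsPreferentialAttachmentTree β μ G) (hβ : -1 < β)
    [IsFiniteMeasure μ] (hp : -(1 + β) < p) (x : List ℕ+) :
    ∃ C : ℝ, 0 < C ∧ ∀ n, 2 ≤ n →
      ∫ ω, degreeMoment β p ((G n ω).degree x) ∂μ ≤ C * growthFactor β p n := by
  induction x using List.reverseRecOn with
  | nil =>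
    have hg2 := growthFactor_pos hβ hp le_rfl
    have h0 : 0 ≤ ∫ ω, degreeMoment β p ((G 2 ω).degree []) ∂μ :=
      integral_nonneg fun ω => degreeMoment_nonneg hβ hp _
    refine ⟨(∫ ω, degreeMoment β p ((G 2 ω).degree []) ∂μ) / growthFactor β p 2 + 1,
      by positivity, fun n hn => ?_⟩
    induction n, hn using Nat.le_induction with
    | base =>
      rw [add_mul, div_mul_cancel₀ _ hg2.ne']
      linarith
    | succ n hn ih =>
      have h := hG.setIntegral_degreeMoment_succ hβ hp hn (x := []) (s := Set.univ)
        MeasurableSet.univ fun ω _ => (G n ω).root_mem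
      simp only [setIntegral_univ] at h
      have hf : 0 < 1 + p / (2 * (n : ℝ) - 2 + (n : ℝ) * β) := by
        have h1 := growthFactor_pos hβ hp hn
        have h2 := growthFactor_pos hβ hp (show 2 ≤ n + 1 by omega)
        rw [growthFactor_succ hβ hp hn] at h2
        exact pos_of_mul_pos_right h2 h1.le
      rw [h, growthFactor_succ hβ hp hn, ← mul_assoc, mul_comm _ (1 + _)]
      exact mul_le_mul_of_nonneg_left ih hf.le
  | append_singleton y j ih =>
    obtain ⟨C, hC, h⟩ := ih
    have ha := degreeMoment_pos hβ hp le_rfl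
    have hb := degreeMoment_pos hβ hp (one_le_degreeAtBirth y j)
    refine ⟨degreeMoment β p 1 / degreeMoment β p (degreeAtBirth y j) * C, by positivity,
      fun n hn => ?_⟩
    have h1 := hG.integral_degreeMoment_child hβ hp y j hn
    have h2 : ∫ ω, {ω | y ++ [j] ∈ (G n ω).verts}.indicator
        (fun ω => degreeMoment β p ((G n ω).degree y)) ω ∂μ ≤ C * growthFactor β p n := by
      refine le_trans (integral_mono ?_ (hG.integrable_comp hβ hn fun T =>
        degreeMoment β p (T.degree y)) fun ω => ?_) (h n hn)
      · exact (hG.integrable_comp hβ hn fun T => degreeMoment β p (T.degree y)).indicator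
          (hG.filtration.le n _ (hG.measurableSet_mem_verts (by omega) le_rfl _))
      · exact Set.indicator_le_self' (fun ω _ => degreeMoment_nonneg hβ hp _) ω
    rw [div_mul_eq_mul_div, div_mul_eq_mul_div, le_div_iff₀ hb, mul_comm _ (degreeMoment β p _),
      h1, mul_assoc]
    exact mul_le_mul_of_nonneg_left h2 ha.le

/-- Convergence of the normalized moments of the degrees, also when they are restricted to events
`s n` that almost surely occur for all large `n`. -/
lemma tendsto_integral_degreeMoment (hG : IsPreferentialAttachmentTree β μ G) (hβ : -1 < β)
    [IsFiniteMeasure μ] (hp : 0 ≤ p) {x : List ℕ+} {ζ : Ω → ℝ} (hpos : ∀ ω, 0 < ζ ω)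
    (hlim : ∀ᵐ ω ∂μ, Tendsto (fun n : ℕ => ((G n ω).degree x : ℝ) / (n : ℝ) ^ (1 / (2 + β)))
      atTop (𝓝 (ζ ω))) {s : ℕ → Set Ω} (hs : ∀ n, 2 ≤ n → MeasurableSet (s n))
    (hs' : ∀ᵐ ω ∂μ, ∀ᶠ n in atTop, ω ∈ s n) :
    Integrable (fun ω => ζ ω ^ p) μ ∧
      Tendsto (fun n : ℕ => (∫ ω, (s n).indicator
        (fun ω => degreeMoment β p ((G n ω).degree x)) ω ∂μ) / (n : ℝ) ^ (p / (2 + β)))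
        atTop (𝓝 (∫ ω, ζ ω ^ p ∂μ)) := by
  have hb : 0 < 2 + β := by linarith
  obtain ⟨K, hK, hsq⟩ := exists_degreeMoment_sq_le hβ hp
  obtain ⟨C, hC, hint⟩ := hG.exists_integral_degreeMoment_le hβ (p := 2 * p) (by linarith) x
  obtain ⟨K', hK', hgr⟩ := growthFactor_le hβ (p := 2 * p) (by linarith)
  set X : ℕ → Ω → ℝ := fun n => (s (n + 2)).indicator (fun ω =>
    degreeMoment β p ((G (n + 2) ω).degree x) / ((n + 2 : ℕ) : ℝ) ^ (p / (2 + β))) with hX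
  have hXm : ∀ n, Measurable (X n) := fun n =>
    ((measurable_from_top (f := fun T : FamilyTree => degreeMoment β p (T.degree x) /
      ((n + 2 : ℕ) : ℝ) ^ (p / (2 + β)))).comp (hG.measurable (n + 2) (by omega))).indicator
      (hs _ (by omega))
  have hg0 : ∀ d, 0 ≤ degreeMoment β p d := degreeMoment_nonneg hβ (by linarith)
  have hXnn : ∀ n ω, 0 ≤ X n ω := fun n => Set.indicator_nonneg fun ω _ =>
    div_nonneg (hg0 _) (by positivity)
  have hle : ∀ n ω, X n ω ^ 2 ≤ K / ((n + 2 : ℕ) : ℝ) ^ (2 * p / (2 + β)) *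
      degreeMoment β (2 * p) ((G (n + 2) ω).degree x) := by
    intro n ω
    have hn0 : (0 : ℝ) < ((n + 2 : ℕ) : ℝ) := by positivity
    have hle1 : X n ω ≤ degreeMoment β p ((G (n + 2) ω).degree x) /
        ((n + 2 : ℕ) : ℝ) ^ (p / (2 + β)) :=
      Set.indicator_le_self' (fun ω _ => div_nonneg (hg0 _) (by positivity)) ω
    refine (pow_le_pow_left₀ (hXnn n ω) hle1 2).trans ?_
    have e : (((n + 2 : ℕ) : ℝ) ^ (p / (2 + β))) ^ 2 = ((n + 2 : ℕ) : ℝ) ^ (2 * p / (2 + β)) := by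
      rw [← Real.rpow_two, ← Real.rpow_mul hn0.le]
      congr 1
      ring
    rw [div_pow, e, div_mul_eq_mul_div]
    exact div_le_div_of_nonneg_right (hsq _) (by positivity)
  have hi2 : ∀ n, Integrable (fun ω => K / ((n + 2 : ℕ) : ℝ) ^ (2 * p / (2 + β)) *
      degreeMoment β (2 * p) ((G (n + 2) ω).degree x)) μ := fun n =>
    hG.integrable_comp hβ (by omega) fun T => K / ((n + 2 : ℕ) : ℝ) ^ (2 * p / (2 + β)) *
      degreeMoment β (2 * p) (T.degree x)
  have hXi : ∀ n, Integrable (fun ω => X n ω ^ 2) μ := fun n =>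
    (hi2 n).mono' ((hXm n).pow_const 2).aestronglyMeasurable (Eventually.of_forall fun ω => by
      rw [Real.norm_of_nonneg (sq_nonneg _)]; exact hle n ω)
  have hXb : ∀ n, ∫ ω, X n ω ^ 2 ∂μ ≤ K * (C * K') := by
    intro n
    have hn0 : (0 : ℝ) < ((n + 2 : ℕ) : ℝ) ^ (2 * p / (2 + β)) := by positivity
    refine (integral_mono (hXi n) (hi2 n) (hle n)).trans ?_
    rw [integral_const_mul, div_mul_eq_mul_div, div_le_iff₀ hn0, mul_assoc]
    refine mul_le_mul_of_nonneg_left ?_ hK.le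
    rw [mul_assoc]
    exact (hint _ (by omega)).trans (mul_le_mul_of_nonneg_left (hgr _ (by omega)) hC.le)
  have hXlim : ∀ᵐ ω ∂μ, Tendsto (fun n => X n ω) atTop (𝓝 (ζ ω ^ p)) := by
    filter_upwards [hlim, hs'] with ω h1 h2
    have hpow : Tendsto (fun n : ℕ => (n : ℝ) ^ (1 / (2 + β))) atTop atTop :=
      (tendsto_rpow_atTop (by positivity)).comp tendsto_natCast_atTop_atTop
    have hdeg : Tendsto (fun n : ℕ => ((G n ω).degree x : ℝ)) atTop atTop := by
      refine (h1.pos_mul_atTop (hpos ω) hpow).congr' ?_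
      filter_upwards [eventually_ge_atTop 1] with n hn
      have : (0 : ℝ) < (n : ℝ) ^ (1 / (2 + β)) :=
        Real.rpow_pos_of_pos (by exact_mod_cast (by omega : 0 < n)) _
      field_simp
    have hdeg' : Tendsto (fun n : ℕ => (G n ω).degree x) atTop atTop :=
      tendsto_natCast_atTop_iff.1 hdeg
    have h3 := ((tendsto_degreeMoment_div hβ (p := p) (by linarith)).comp hdeg').mul
      (h1.rpow_const (p := p) (Or.inr hp))
    rw [one_mul] at h3
    refine (tendsto_add_atTop_iff_nat (f := fun n : ℕ => (s n).indicator (fun ω =>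
      degreeMoment β p ((G n ω).degree x) / (n : ℝ) ^ (p / (2 + β))) ω) 2).2 (h3.congr' ?_)
    filter_upwards [h2, hdeg'.eventually_ge_atTop 1] with n hn hd
    have hd0 : (0 : ℝ) < (G n ω).degree x := by exact_mod_cast hd
    have hdp := Real.rpow_pos_of_pos hd0 p
    rw [Set.indicator_of_mem hn, Real.div_rpow hd0.le (by positivity),
      ← Real.rpow_mul (Nat.cast_nonneg n), one_div_mul_eq_div]
    simp only [Function.comp]
    field_simp
  obtain ⟨hI, hT⟩ := tendsto_integral_of_integral_sq_le hXm hXnn hXi hXb hXlim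
  refine ⟨hI, (tendsto_add_atTop_iff_nat 2).1 (hT.congr fun n => ?_)⟩
  rw [← integral_div]
  refine integral_congr_ae (Eventually.of_forall fun ω => ?_)
  simp only [hX]
  by_cases hω : ω ∈ s (n + 2)
  · rw [Set.indicator_of_mem hω, Set.indicator_of_mem hω]
  · rw [Set.indicator_of_notMem hω, Set.indicator_of_notMem hω, zero_div]

lemma integrable_limit_rpow (hG : IsPreferentialAttachmentTree β μ G) (hβ : -1 < β)
    [IsFiniteMeasure μ] (hp : 0 ≤ p) {x : List ℕ+} {ζ : Ω → ℝ} (hpos : ∀ ω, 0 < ζ ω)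
    (hlim : ∀ᵐ ω ∂μ, Tendsto (fun n : ℕ => ((G n ω).degree x : ℝ) / (n : ℝ) ^ (1 / (2 + β)))
      atTop (𝓝 (ζ ω))) : Integrable (fun ω => ζ ω ^ p) μ :=
  (hG.tendsto_integral_degreeMoment hβ hp hpos hlim (s := fun _ => Set.univ)
    (fun _ _ => MeasurableSet.univ) (Eventually.of_forall fun _ => Eventually.of_forall
      fun _ => Set.mem_univ _)).1

/-- The moments of the limits at a vertex and at its child have the ratio of the moments of a beta
law. -/
lemma integral_limit_rpow_child (hG : IsPreferentialAttachmentTree β μ G) (hβ : -1 < β)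
    [IsFiniteMeasure μ] (hp : 0 ≤ p) {y : List ℕ+} {j : ℕ+} {ζ ξ : Ω → ℝ} (hζ : ∀ ω, 0 < ζ ω)
    (hξ : ∀ ω, 0 < ξ ω)
    (hζlim : ∀ᵐ ω ∂μ, Tendsto (fun n : ℕ => ((G n ω).degree y : ℝ) / (n : ℝ) ^ (1 / (2 + β)))
      atTop (𝓝 (ζ ω)))
    (hξlim : ∀ᵐ ω ∂μ, Tendsto (fun n : ℕ => ((G n ω).degree (y ++ [j]) : ℝ) /
      (n : ℝ) ^ (1 / (2 + β))) atTop (𝓝 (ξ ω))) :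
    ∫ ω, ξ ω ^ p ∂μ = degreeMoment β p 1 / degreeMoment β p (degreeAtBirth y j) *
      ∫ ω, ζ ω ^ p ∂μ := by
  have h1 := (hG.tendsto_integral_degreeMoment hβ hp hξ hξlim (s := fun _ => Set.univ)
    (fun _ _ => MeasurableSet.univ) (Eventually.of_forall fun _ => Eventually.of_forall
      fun _ => Set.mem_univ _)).2
  have h2 := (hG.tendsto_integral_degreeMoment hβ hp hζ hζlim
    (s := fun n => {ω | y ++ [j] ∈ (G n ω).verts}) (fun n hn => hG.filtration.le n _
      (hG.measurableSet_mem_verts (by omega) le_rfl _)) (hG.ae_eventually_mem_verts hβ _)).2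
  have hb := degreeMoment_pos hβ (p := p) (by linarith) (one_le_degreeAtBirth y j)
  refine tendsto_nhds_unique h1 ((h2.const_mul _).congr' ?_)
  filter_upwards [eventually_ge_atTop 2] with n hn
  simp only [Set.indicator_univ]
  have h3 := hG.integral_degreeMoment_child hβ (p := p) (by linarith) y j hn
  rw [div_mul_div_comm, ← h3, mul_div_mul_left _ _ hb.ne']

end IsPreferentialAttachmentTree

/-! ### Positive moments determine the law -/

section Mellin

variable {Ω Ω' : Type*} [MeasurableSpace Ω] [MeasurableSpace Ω'] {μ : Measure Ω} {P : Measure Ω'}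
  {X : Ω → ℝ} {Y : Ω' → ℝ}

/-- Continuity of the complex moment generating function up to the imaginary axis, along the
horizontal approach from the right. -/
lemma tendsto_complexMGF_mul_I [IsFiniteMeasure μ] (hX : Measurable X)
    (hint : Integrable (fun ω => Real.exp (X ω)) μ) (t : ℝ) :
    Tendsto (fun n : ℕ => complexMGF X μ (((1 / ((n : ℝ) + 1) : ℝ) : ℂ) + t * Complex.I)) atTop
      (𝓝 (complexMGF X μ (t * Complex.I))) := by
  have h0 : Tendsto (fun n : ℕ => (((1 / ((n : ℝ) + 1) : ℝ) : ℂ) + t * Complex.I)) atTop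
      (𝓝 (t * Complex.I)) := by
    have := (Complex.continuous_ofReal.tendsto 0).comp tendsto_one_div_add_atTop_nhds_zero_nat
    simpa using this.add_const ((t : ℂ) * Complex.I)
  refine tendsto_integral_of_dominated_convergence (fun ω => 1 + Real.exp (X ω)) ?_
    ((integrable_const _).add hint) ?_ ?_
  · intro n
    exact (by fun_prop : Measurable fun ω =>
      Complex.exp ((((1 / ((n : ℝ) + 1) : ℝ) : ℂ) + t * Complex.I) * X ω)).aestronglyMeasurable
  · intro n
    refine Eventually.of_forall fun ω => ?_
    have hre : ((((1 / ((n : ℝ) + 1) : ℝ) : ℂ) + t * Complex.I) * X ω).re =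
        1 / ((n : ℝ) + 1) * X ω := by
      simp only [Complex.re_mul_ofReal, Complex.add_re, Complex.ofReal_re, Complex.re_ofReal_mul,
        Complex.I_re, mul_zero, add_zero]
    rw [Complex.norm_exp, hre]
    have hn : 0 < 1 / ((n : ℝ) + 1) := by positivity
    have hn1 : 1 / ((n : ℝ) + 1) ≤ 1 := by
      rw [div_le_one (by positivity)]
      linarith [(Nat.cast_nonneg n : (0 : ℝ) ≤ n)]
    rcases le_total (X ω) 0 with h | h
    · have := Real.exp_le_one_iff.2 (mul_nonpos_of_nonneg_of_nonpos hn.le h)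
      linarith [Real.exp_pos (X ω)]
    · have := Real.exp_le_exp.2 (mul_le_of_le_one_left h hn1)
      linarith
  · exact Eventually.of_forall fun ω =>
      (Complex.continuous_exp.tendsto _).comp (h0.mul_const _)

/-- The values of the moment generating function at positive arguments determine the law: the
complex moment generating functions agree on the right half-plane by the identity theorem, hence
on its boundary, where they are the characteristic functions. -/
lemma map_eq_map_of_mgf_eq_of_pos [IsFiniteMeasure μ] [IsFiniteMeasure P] (hX : Measurable X)
    (hY : Measurable Y) (hXi : ∀ p : ℝ, 0 < p → Integrable (fun ω => Real.exp (p * X ω)) μ)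
    (hYi : ∀ p : ℝ, 0 < p → Integrable (fun ω => Real.exp (p * Y ω)) P)
    (h : ∀ p : ℝ, 0 < p → mgf X μ p = mgf Y P p) : μ.map X = P.map Y := by
  have hU : IsOpen (Set.Ioi (0 : ℝ)) := isOpen_Ioi
  have hsubX : Set.Ioi (0 : ℝ) ⊆ interior (integrableExpSet X μ) :=
    interior_maximal (fun p hp => hXi p hp) hU
  have hsubY : Set.Ioi (0 : ℝ) ⊆ interior (integrableExpSet Y P) :=
    interior_maximal (fun p hp => hYi p hp) hU
  have hAX : AnalyticOnNhd ℂ (complexMGF X μ) {z | z.re ∈ Set.Ioi (0 : ℝ)} :=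
    analyticOnNhd_complexMGF.mono fun z hz => hsubX hz
  have hAY : AnalyticOnNhd ℂ (complexMGF Y P) {z | z.re ∈ Set.Ioi (0 : ℝ)} :=
    analyticOnNhd_complexMGF.mono fun z hz => hsubY hz
  have heq : Set.EqOn (complexMGF X μ) (complexMGF Y P) {z | z.re ∈ Set.Ioi (0 : ℝ)} := by
    refine AnalyticOnNhd.eqOn_of_preconnected_of_frequently_eq hAX hAY
      ((convex_Ioi 0).linear_preimage Complex.reLm).isPreconnected
      (z₀ := ((1 : ℝ) : ℂ)) (by simp) ?_
    have hseq : Tendsto (fun n : ℕ => ((1 + 1 / ((n : ℝ) + 1) : ℝ) : ℂ)) atTop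
        (𝓝[≠] ((1 : ℝ) : ℂ)) := by
      rw [tendsto_nhdsWithin_iff]
      constructor
      · rw [tendsto_ofReal_iff]
        simpa using tendsto_one_div_add_atTop_nhds_zero_nat.const_add (1 : ℝ)
      · refine Eventually.of_forall fun n => ?_
        have : (0 : ℝ) < 1 / ((n : ℝ) + 1) := by positivity
        simp only [Set.mem_compl_iff, Set.mem_singleton_iff, Complex.ofReal_inj]
        linarith
    refine hseq.frequently (Frequently.of_forall fun n => ?_)
    have : (0 : ℝ) < 1 + 1 / ((n : ℝ) + 1) := by positivity
    rw [complexMGF_ofReal, complexMGF_ofReal, h _ this]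
  refine Measure.ext_of_charFun ?_
  ext t
  rw [← complexMGF_mul_I hX.aemeasurable, ← complexMGF_mul_I hY.aemeasurable]
  refine tendsto_nhds_unique (tendsto_complexMGF_mul_I hX (by simpa using hXi 1 one_pos) t)
    ((tendsto_complexMGF_mul_I hY (by simpa using hYi 1 one_pos) t).congr fun n => ?_)
  refine (heq ?_).symm
  rw [Set.mem_ofPred_eq, Complex.add_re, Complex.ofReal_re, Complex.re_ofReal_mul, Complex.I_re,
    mul_zero, add_zero]
  exact Set.mem_Ioi.2 (by positivity)

/-- Positive random variables whose moments of all positive real orders are finite and agree have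
the same law. -/
lemma map_eq_map_of_lintegral_rpow_eq [IsFiniteMeasure μ] [IsFiniteMeasure P] (hX : Measurable X)
    (hY : Measurable Y) (hXpos : ∀ᵐ ω ∂μ, 0 < X ω) (hYpos : ∀ᵐ ω ∂P, 0 < Y ω)
    (hfin : ∀ p : ℝ, 0 < p → ∫⁻ ω, ENNReal.ofReal (X ω ^ p) ∂μ ≠ ⊤)
    (h : ∀ p : ℝ, 0 < p →
      ∫⁻ ω, ENNReal.ofReal (X ω ^ p) ∂μ = ∫⁻ ω, ENNReal.ofReal (Y ω ^ p) ∂P) :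
    μ.map X = P.map Y := by
  have hlX : ∀ p : ℝ, ∫⁻ ω, ENNReal.ofReal (Real.exp (p * Real.log (X ω))) ∂μ =
      ∫⁻ ω, ENNReal.ofReal (X ω ^ p) ∂μ := fun p => lintegral_congr_ae (by
    filter_upwards [hXpos] with ω hω
    rw [Real.rpow_def_of_pos hω, mul_comm])
  have hlY : ∀ p : ℝ, ∫⁻ ω, ENNReal.ofReal (Real.exp (p * Real.log (Y ω))) ∂P =
      ∫⁻ ω, ENNReal.ofReal (Y ω ^ p) ∂P := fun p => lintegral_congr_ae (by
    filter_upwards [hYpos] with ω hω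
    rw [Real.rpow_def_of_pos hω, mul_comm])
  have key : μ.map (fun ω => Real.log (X ω)) = P.map (fun ω => Real.log (Y ω)) := by
    refine map_eq_map_of_mgf_eq_of_pos (by fun_prop) (by fun_prop) ?_ ?_ ?_
    · intro p hp
      refine (lintegral_ofReal_ne_top_iff_integrable
        (Measurable.aestronglyMeasurable (by fun_prop))
        (Eventually.of_forall fun ω => (Real.exp_pos _).le)).1 ?_
      rw [hlX]
      exact hfin p hp
    · intro p hp
      refine (lintegral_ofReal_ne_top_iff_integrable
        (Measurable.aestronglyMeasurable (by fun_prop))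
        (Eventually.of_forall fun ω => (Real.exp_pos _).le)).1 ?_
      rw [hlY, ← h p hp]
      exact hfin p hp
    · intro p hp
      rw [mgf, mgf, integral_eq_lintegral_of_nonneg_ae
        (Eventually.of_forall fun ω => (Real.exp_pos _).le)
        (Measurable.aestronglyMeasurable (by fun_prop)), integral_eq_lintegral_of_nonneg_ae
        (Eventually.of_forall fun ω => (Real.exp_pos _).le)
        (Measurable.aestronglyMeasurable (by fun_prop)), hlX, hlY, h p hp]
  have key2 := congrArg (Measure.map Real.exp) key
  rw [Measure.map_map Real.measurable_exp (by fun_prop),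
    Measure.map_map Real.measurable_exp (by fun_prop)] at key2
  rw [← Measure.map_congr (f := Real.exp ∘ fun ω => Real.log (X ω)) (g := X),
    ← Measure.map_congr (f := Real.exp ∘ fun ω => Real.log (Y ω)) (g := Y), key2]
  · filter_upwards [hYpos] with ω hω using Real.exp_log hω
  · filter_upwards [hXpos] with ω hω using Real.exp_log hω

end Mellin

/-! ### Moments of the beta factors -/

lemma lintegral_rpow_betaMeasure {a b p : ℝ} (ha : 0 < a) (hb : 0 < b) (hp : 0 ≤ p) :
    ∫⁻ t, ENNReal.ofReal (t ^ p) ∂(betaMeasure a b) =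
      ENNReal.ofReal (gammaRatio a p / gammaRatio (a + b) p) := by
  have hap : 0 < a + p := by linarith
  have hBa := beta_pos ha hb
  have hBap := beta_pos hap hb
  have hr : 0 < beta (a + p) b / beta a b := by positivity
  have hratio : gammaRatio a p / gammaRatio (a + b) p = beta (a + p) b / beta a b := by
    have h1 := Real.Gamma_pos_of_pos ha
    have h2 := Real.Gamma_pos_of_pos hb
    have h3 := Real.Gamma_pos_of_pos hap
    have h4 := Real.Gamma_pos_of_pos (show 0 < a + b by linarith)
    have h5 := Real.Gamma_pos_of_pos (show 0 < a + b + p by linarith)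
    rw [gammaRatio, gammaRatio, beta, beta, add_right_comm a p b]
    field_simp
  have hpdf : ∀ t : ℝ, betaPDF a b t * ENNReal.ofReal (t ^ p) =
      ENNReal.ofReal (beta (a + p) b / beta a b) * betaPDF (a + p) b t := by
    intro t
    by_cases ht : 0 < t ∧ t < 1
    · rw [betaPDF_of_pos_lt_one ht.1 ht.2, betaPDF_of_pos_lt_one ht.1 ht.2,
        ← ENNReal.ofReal_mul hr.le, ← ENNReal.ofReal_mul' (Real.rpow_nonneg ht.1.le p)]
      congr 1
      rw [show a + p - 1 = (a - 1) + p by ring, Real.rpow_add ht.1]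
      field_simp
    · rw [betaPDF_eq, betaPDF_eq, if_neg ht, if_neg ht]
      simp
  have hm : Measurable (betaPDF a b) := (measurable_betaPDFReal a b).ennreal_ofReal
  have hm' : Measurable (betaPDF (a + p) b) := (measurable_betaPDFReal _ _).ennreal_ofReal
  rw [betaMeasure, lintegral_withDensity_eq_lintegral_mul _ hm (by fun_prop)]
  simp only [Pi.mul_apply, hpdf]
  rw [lintegral_const_mul _ hm',
    lintegral_betaPDF_eq_one hap hb, mul_one, hratio]

lemma ae_pos_betaMeasure (a b : ℝ) : ∀ᵐ t ∂(betaMeasure a b), 0 < t := by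
  have hm : Measurable (betaPDF a b) := (measurable_betaPDFReal a b).ennreal_ofReal
  rw [betaMeasure, ae_withDensity_iff hm]
  refine Eventually.of_forall fun t ht => ?_
  by_contra hneg
  exact ht (betaPDF_eq_zero_of_nonpos (not_lt.1 hneg))

section FactorLaw

variable {β : ℝ}

/-- The moment of order `p` of the factor for a child of label `j` at depth `i + 1`. -/
noncomputable def factorMoment (β p : ℝ) (i : ℕ) (j : ℕ+) : ℝ :=
  degreeMoment β p 1 / degreeMoment β p ((j : ℕ) + if i = 0 then 0 else 1)

lemma factorMoment_pos {p : ℝ} (hβ : -1 < β) (hp : 0 ≤ p) (i : ℕ) (j : ℕ+) :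
    0 < factorMoment β p i j :=
  div_pos (degreeMoment_pos hβ (by linarith) le_rfl)
    (degreeMoment_pos hβ (by linarith) (j.pos.trans_le (Nat.le_add_right _ _)))

/-- Every factor is a point mass at `1` or a beta law with positive parameters. -/
lemma factorLaw_cases (x : List ℕ+) (i : Fin x.length) :
    (((x.get i : ℕ) + if (i : ℕ) = 0 then 0 else 1) = 1 ∧ factorLaw β x i = Measure.dirac 1) ∨
    ∃ b : ℝ, 0 < b ∧ factorLaw β x i = betaMeasure (1 + β) b ∧
      (((x.get i : ℕ) + if (i : ℕ) = 0 then 0 else 1 : ℕ) : ℝ) = 1 + b := by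
  have hj : 1 ≤ (x.get i : ℕ) := (x.get i).pos
  by_cases hi : (i : ℕ) = 0
  · by_cases hx : x.get i = 1
    · left
      rw [factorLaw, if_pos hi, if_pos hx, if_pos hi, hx]
      exact ⟨rfl, rfl⟩
    · right
      have h1 : (x.get i : ℕ) ≠ 1 := fun h => hx (PNat.coe_eq_one_iff.1 h)
      have h2 : (2 : ℝ) ≤ ((x.get i : ℕ) : ℝ) := by
        exact_mod_cast (show 2 ≤ (x.get i : ℕ) by omega)
      refine ⟨((x.get i : ℕ) : ℝ) - 1, by linarith, ?_, ?_⟩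
      · rw [factorLaw, if_pos hi, if_neg hx]
      · rw [if_pos hi, add_zero]
        ring
  · right
    refine ⟨((x.get i : ℕ) : ℝ), by exact_mod_cast hj, ?_, ?_⟩
    · rw [factorLaw, if_neg hi]
    · rw [if_neg hi]
      push_cast
      ring

lemma isProbabilityMeasure_factorLaw (hβ : -1 < β) (x : List ℕ+) (i : Fin x.length) :
    IsProbabilityMeasure (factorLaw β x i) := by
  rcases factorLaw_cases (β := β) x i with ⟨-, h⟩ | ⟨b, hb, h, -⟩
  · rw [h]; infer_instance
  · rw [h]; exact isProbabilityMeasureBeta (by linarith) hb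

lemma ae_pos_factorLaw (x : List ℕ+) (i : Fin x.length) : ∀ᵐ t ∂(factorLaw β x i), 0 < t := by
  rcases factorLaw_cases (β := β) x i with ⟨-, h⟩ | ⟨b, hb, h, -⟩
  · rw [h, ae_dirac_iff measurableSet_Ioi]
    exact one_pos
  · rw [h]; exact ae_pos_betaMeasure _ _

lemma lintegral_rpow_factorLaw {p : ℝ} (hβ : -1 < β) (hp : 0 ≤ p) (x : List ℕ+)
    (i : Fin x.length) : ∫⁻ t, ENNReal.ofReal (t ^ p) ∂(factorLaw β x i) =
      ENNReal.ofReal (factorMoment β p i (x.get i)) := by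
  rcases factorLaw_cases (β := β) x i with ⟨hk, h⟩ | ⟨b, hb, h, hk⟩
  · rw [h, lintegral_dirac' _ (by fun_prop), factorMoment, hk,
      div_self (degreeMoment_pos hβ (by linarith) le_rfl).ne', Real.one_rpow]
  · rw [h, lintegral_rpow_betaMeasure (by linarith) hb hp, factorMoment, degreeMoment,
      degreeMoment, if_neg one_ne_zero, if_neg, hk, Nat.cast_one, add_right_comm]
    have := (x.get i).pos
    omega

end FactorLaw

/-! ### Identification of the law -/

namespace IsPreferentialAttachmentTree

variable {Ω : Type*} [MeasurableSpace Ω] {μ : Measure Ω} {β p : ℝ} {G : ℕ → Ω → FamilyTree}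

lemma integral_limit_rpow (hG : IsPreferentialAttachmentTree β μ G) (hβ : -1 < β)
    [IsFiniteMeasure μ] (hp : 0 ≤ p) {ζ : List ℕ+ → Ω → ℝ} (hpos : ∀ x ω, 0 < ζ x ω)
    (hlim : ∀ x, ∀ᵐ ω ∂μ, Tendsto
      (fun n : ℕ => ((G n ω).degree x : ℝ) / (n : ℝ) ^ (1 / (2 + β))) atTop (𝓝 (ζ x ω)))
    (x : List ℕ+) :
    ∫ ω, ζ x ω ^ p ∂μ =
      (∫ ω, ζ [] ω ^ p ∂μ) * ∏ i : Fin x.length, factorMoment β p i (x.get i) := by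
  rw [← List.prod_ofFn, ← List.mapIdx_eq_ofFn x (factorMoment β p)]
  induction x using List.reverseRecOn with
  | nil => simp
  | append_singleton y j ih =>
    rw [hG.integral_limit_rpow_child hβ hp (hpos y) (hpos (y ++ [j])) (hlim y) (hlim (y ++ [j])),
      ih, List.mapIdx_append_one, List.prod_append, List.prod_singleton, factorMoment,
      degreeAtBirth]
    simp only [List.length_eq_zero_iff]
    ring

end IsPreferentialAttachmentTree

theorem theorem1 {Ω : Type*} [MeasurableSpace Ω] (μ : Measure Ω) [IsProbabilityMeasure μ]
    (β : ℝ) (hβ : -1 < β) (G : ℕ → Ω → FamilyTree)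
    (hG : IsPreferentialAttachmentTree β μ G) :
    ∃ ζ₀ : Ω → ℝ, Measurable ζ₀ ∧ (∀ ω, 0 < ζ₀ ω) ∧
      (∀ᵐ ω ∂μ, Tendsto (fun n : ℕ => ((G n ω).degree [] : ℝ) / (n : ℝ) ^ (1 / (2 + β)))
        atTop (𝓝 (ζ₀ ω))) ∧
      ∀ x : List ℕ+, x ≠ [] →
        ∃ ζ : Ω → ℝ, Measurable ζ ∧ (∀ ω, 0 < ζ ω) ∧
          (∀ᵐ ω ∂μ, Tendsto (fun n : ℕ => ((G n ω).degree x : ℝ) / (n : ℝ) ^ (1 / (2 + β)))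
            atTop (𝓝 (ζ ω))) ∧
          ∃ (Ω' : Type) (_ : MeasurableSpace Ω') (P : Measure Ω') (_ : IsProbabilityMeasure P)
            (Y : Fin (x.length + 1) → Ω' → ℝ),
            (∀ i, Measurable (Y i)) ∧ iIndepFun Y P ∧
            P.map (Y 0) = μ.map ζ₀ ∧
            (∀ i : Fin x.length, P.map (Y i.succ) = factorLaw β x i) ∧
            μ.map ζ = P.map (fun ω' => Y 0 ω' * ∏ i : Fin x.length, Y i.succ ω') := by
  choose ζ hm hpos hlim using fun x => hG.exists_limit hβ x
  refine ⟨ζ [], hm [], hpos [], hlim [], fun x _ => ⟨ζ x, hm x, hpos x, hlim x, ?_⟩⟩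
  let ν : Fin (x.length + 1) → Measure ℝ := Fin.cons (μ.map (ζ [])) (factorLaw β x)
  have hν : ∀ i, IsProbabilityMeasure (ν i) := by
    refine Fin.cases ?_ fun i => ?_
    · exact Measure.isProbabilityMeasure_map (hm []).aemeasurable
    · exact isProbabilityMeasure_factorLaw hβ x i
  have hmap : ∀ i, (Measure.pi ν).map (fun t => t i) = ν i := fun i =>
    (measurePreserving_eval ν i).map_eq
  have hindep : iIndepFun (fun i (t : Fin (x.length + 1) → ℝ) => t i) (Measure.pi ν) :=
    iIndepFun_pi (X := fun _ t => t) fun _ => aemeasurable_id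
  have hνpos : ∀ i, ∀ᵐ t ∂(ν i), 0 < t := by
    refine Fin.cases ?_ fun i => ?_
    · exact (ae_map_iff (hm []).aemeasurable measurableSet_Ioi).2 (Eventually.of_forall (hpos []))
    · exact ae_pos_factorLaw x i
  have hae : ∀ᵐ t ∂(Measure.pi ν), ∀ i, 0 < t i := by
    rw [ae_all_iff]
    exact fun i => (measurePreserving_eval ν i).quasiMeasurePreserving.ae (hνpos i)
  refine ⟨Fin (x.length + 1) → ℝ, inferInstance, Measure.pi ν, inferInstance, fun i t => t i,
    fun i => measurable_pi_apply i, hindep, hmap 0, fun i => hmap i.succ, ?_⟩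
  have hprod : (fun t : Fin (x.length + 1) → ℝ => t 0 * ∏ i : Fin x.length, t i.succ) =
      fun t => ∏ i, t i := by
    funext t
    rw [Fin.prod_univ_succ]
  rw [hprod]
  have hmom : ∀ p : ℝ, 0 ≤ p → ∫⁻ ω, ENNReal.ofReal (ζ x ω ^ p) ∂μ =
      ENNReal.ofReal (∫ ω, ζ x ω ^ p ∂μ) := fun p hp =>
    (ofReal_integral_eq_lintegral_ofReal (hG.integrable_limit_rpow hβ hp (hpos x) (hlim x))
      (Eventually.of_forall fun ω => Real.rpow_nonneg (hpos x ω).le p)).symm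
  refine map_eq_map_of_lintegral_rpow_eq (hm x) (by fun_prop)
    (Eventually.of_forall (hpos x)) ?_ (fun p hp => ?_) fun p hp => ?_
  · filter_upwards [hae] with t ht using Finset.prod_pos fun i _ => ht i
  · rw [hmom p hp.le]
    exact ENNReal.ofReal_ne_top
  · have hsplit : ∫⁻ t, ENNReal.ofReal ((∏ i, t i) ^ p) ∂(Measure.pi ν) =
        ∫⁻ t, ∏ i, ENNReal.ofReal (t i ^ p) ∂(Measure.pi ν) := by
      refine lintegral_congr_ae ?_
      filter_upwards [hae] with t ht
      rw [← Real.finsetProd_rpow _ _ fun i _ => (ht i).le, ENNReal.ofReal_prod_of_nonneg]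
      exact fun i _ => Real.rpow_nonneg (ht i).le p
    have hcomp : iIndepFun (fun i (t : Fin (x.length + 1) → ℝ) => ENNReal.ofReal (t i ^ p))
        (Measure.pi ν) :=
      hindep.comp (fun _ s => ENNReal.ofReal (s ^ p)) fun _ => by fun_prop
    have hfac : ∀ i, ∫⁻ t, ENNReal.ofReal (t i ^ p) ∂(Measure.pi ν) =
        ∫⁻ s, ENNReal.ofReal (s ^ p) ∂(ν i) := fun i =>
      (measurePreserving_eval ν i).lintegral_comp (f := fun s => ENNReal.ofReal (s ^ p))
        (by fun_prop)
    have h0 : ∫⁻ s, ENNReal.ofReal (s ^ p) ∂(ν 0) = ENNReal.ofReal (∫ ω, ζ [] ω ^ p ∂μ) := by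
      rw [ofReal_integral_eq_lintegral_ofReal
        (hG.integrable_limit_rpow hβ hp.le (hpos []) (hlim []))
        (Eventually.of_forall fun ω => Real.rpow_nonneg (hpos [] ω).le p)]
      exact lintegral_map (by fun_prop) (hm [])
    have hi : ∀ i : Fin x.length, ∫⁻ s, ENNReal.ofReal (s ^ p) ∂(ν i.succ) =
        ENNReal.ofReal (factorMoment β p i (x.get i)) :=
      fun i => lintegral_rpow_factorLaw hβ hp.le x i
    rw [hsplit, lintegral_prod_eq_prod_lintegral_of_indepFun _ _ hcomp fun i => by fun_prop,
      Fin.prod_univ_succ, hfac, h0, hmom p hp.le, hG.integral_limit_rpow hβ hp.le hpos hlim x,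
      ENNReal.ofReal_mul (integral_nonneg fun ω => Real.rpow_nonneg (hpos [] ω).le p),
      ENNReal.ofReal_prod_of_nonneg fun i _ => (factorMoment_pos hβ hp.le _ _).le]
    congr 1
    exact Finset.prod_congr rfl fun i _ => by rw [hfac, hi]
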